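/- Let $n\ge 2$. There is a constant $C(n)>0$, depending only on $n$, such that the following holds. Let $\delta\in(0,\pi/2)$, $0<r<R<R'$ and $\epsilon>0$ with $R-r>2\epsilon$, and write $B_s=B_s(0)\subset\mathbb{R}^n$ for the open ball of radius $s$. Let $u$ be a smooth function on $B_{R'}$ with $D^2u\ge-\cot(\delta)\,I_n$ on $B_{R'}$, and let $f$ be a smooth positive function on the Lagrangian graph $X=\{(x,Du(x)):x\in B_{R'}\}$, regarded as a function of $x\in B_{R'}$. Let $g=I_n+(D^2u)^2$ be the induced metric, $dv_g=\sqrt{\det g}\,dx$, and $|\nabla_g v|=(g^{ij}v_iv_j)^{1/2}$, where $(g^{ij})=g^{-1}$ and $v_i=\partial_i v$ (defined almost everywhere for locally Lipschitz $v$). Put $$\tilde f=\frac{2}{|B_r|}\int_{B_R}f\,dx,\qquad \rho=R'+\|Du\|_{L^\infty(B_{R'})}.$$ Then $$\left[\int_{B_r}|(f-\tilde f)^+|^{\frac{n}{n-1}}\,dv_g\right]^{\frac{n-1}{n}}\le C(n)\left(\frac{\csc^2(\delta/2)\,\rho^2}{r\,\epsilon}\right)^{n-1}\int_{B_R}|\nabla_g(f-\tilde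 f)^+|\,dv_g .$$ If $Du$ is unbounded on $B_{R'}$, so that $\rho=\infty$, the right-hand side is read with the convention $\infty\cdot 0=0$. -/

import Mathlib

open MeasureTheory Metric
open scoped ENNReal ContDiff Matrix

noncomputable section

namespace GradientGraph

variable {n : ℕ}

/-- The partial derivatives `v_i = ∂_i v (x)`. -/
def partials (v : EuclideanSpace ℝ (Fin n) → ℝ) (x : EuclideanSpace ℝ (Fin n)) : Fin n → ℝ :=
  fun i => fderiv ℝ v x (EuclideanSpace.single i 1)

/-- The Hessian matrix `D²u (x) = (u_{ij})`. -/
def hessian (u : EuclideanSpace ℝ (Fin n) → ℝ) (x : EuclideanSpace ℝ (Fin n)) :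
    Matrix (Fin n) (Fin n) ℝ :=
  Matrix.of fun i j =>
    fderiv ℝ (fderiv ℝ u) x (EuclideanSpace.single i 1) (EuclideanSpace.single j 1)

/-- The metric `g = I + (D²u)²` induced on the graph `X = (x, Du(x))`, in the coordinates `x`. -/
def metric (u : EuclideanSpace ℝ (Fin n) → ℝ) (x : EuclideanSpace ℝ (Fin n)) :
    Matrix (Fin n) (Fin n) ℝ :=
  1 + hessian u x ^ 2

/-- The volume measure `dv_g = √(det g) dx`. -/
def volG (u : EuclideanSpace ℝ (Fin n) → ℝ) : Measure (EuclideanSpace ℝ (Fin n)) :=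
  volume.withDensity fun x => ENNReal.ofReal √(metric u x).det

/-- The length `|∇_g v| = (g^{ij} v_i v_j)^{1/2}` of the gradient with respect to `g`. For a locally
Lipschitz `v`, such as the positive part of a smooth function, it is meant almost everywhere. -/
def gradNormG (u v : EuclideanSpace ℝ (Fin n) → ℝ) (x : EuclideanSpace ℝ (Fin n)) : ℝ :=
  √(partials v x ⬝ᵥ ((metric u x)⁻¹ *ᵥ partials v x))

/-- `ρ(s) = s + ‖Du‖_{L^∞(B_s)}`, which is `∞` if `Du` is unbounded on `B_s`. -/
def rho (u : EuclideanSpace ℝ (Fin n) → ℝ) (s : ℝ) : ℝ≥0∞ :=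
  ENNReal.ofReal s + eLpNorm (gradient u) ⊤ (volume.restrict (ball 0 s))

/-- `f̃ = 2 / |B_r| ∫_{B_R} f dx`. -/
def ftilde (f : EuclideanSpace ℝ (Fin n) → ℝ) (r R : ℝ) : ℝ :=
  2 / volume.real (ball (0 : EuclideanSpace ℝ (Fin n)) r) *
    ∫ x in ball (0 : EuclideanSpace ℝ (Fin n)) R, f x

/-- The positive part `(f - f̃)^+`. -/
def excess (f : EuclideanSpace ℝ (Fin n) → ℝ) (r R : ℝ) (x : EuclideanSpace ℝ (Fin n)) : ℝ :=
  max (f x - ftilde f r R) 0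

end GradientGraph

end

/-!
The angle `arctan l` of every eigenvalue `l` of `D²u` lies in `[δ - π/2, π/2)`, so after a rotation
by `δ / 2` the graph of `Du` is a gradient graph over the coordinates
`x̄ = cos (δ/2) x + sin (δ/2) Du(x)` (`rotatedMap`), with slope at most `cot (δ/2)`. In these
coordinates the induced metric is comparable to the Euclidean one. With `c = cos (δ/2)` and
`s = sin (δ/2)`, the Jacobian matrix `A = c + s D²u` commutes with `g = 1 + (D²u)²`, and
`s² g ≤ A² ≤ g`. Hence `dv_g ≤ s⁻ⁿ dx̄`, and `|∇_g v| dv_g` is at least the Euclidean `|∇v| dx̄`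
(`rotatedJacobian_metric_comparison`). Moreover `x ↦ x̄` expands distances at least by the factor
`1/2` (`norm_sub_le_two_mul_norm_rotatedMap_sub`), so the image `T` of `B_R` contains the
`ε`-neighbourhood of the image `S` of `B_r` (`ball_subset_image_ball`), while `S` lies in a ball of
radius `ρ`.

What remains is a Euclidean inequality for the connected set `S` and its neighbourhood `T`. On a
ball of radius comparable to `ε`, the function `v` differs from its mean, in the critical Lebesgue
norm, by at most a constant times the integral of `|∇v|` over a larger ball
(`exists_eLpNorm_sub_ballMean_le`). Summing over a lattice costs only a bounded overlap. The mean
over the ball around a moving point of `S` is a continuous function with connected image, an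
interval whose length is at most the sum of its oscillations over the lattice cells; so all
means agree up to `C ε^(1-n) ∫_T |∇v|`. This gives `‖v - c‖ ≤ C (ρ/ε)^(n-1) ∫_T |∇v|` over `S` for
some constant `c`
(`exists_eLpNorm_sub_const_le`). By Markov's inequality `f ≤ f̃` on at least half of `B_r`, so
`v = (f - f̃)^+` vanishes on a part of `S` of measure at least `2^(-n-1) |B_r|`; this bounds `c` and
costs the second factor `(ρ/r)^(n-1)` (`exists_eLpNorm_le_of_volume_zeroSet`).

The positive part is only Lipschitz and is replaced by `C¹` approximations (`smoothedPosPart`) whose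
gradients are no longer than that of `(f - f̃)^+`. Only the supremum of `|Du|` over the compact ball
of radius `R` enters the bound on `S`, so the case `ρ = ∞` needs no separate treatment.
-/

/-! ### Sobolev–Poincaré inequality on a ball -/

section LocalSobolev

variable {E : Type*} [NormedAddCommGroup E]

lemma enorm_average_le [MeasurableSpace E] (μ : Measure E) [μ.IsOpenPosMeasure] {s : ℝ}
    (hs : 0 < s) (h : E → ℝ) :
    ‖⨍ y in ball (0 : E) s, h y ∂μ‖ₑ ≤ (μ (ball 0 s))⁻¹ * ∫⁻ y in ball (0 : E) s, ‖h y‖ₑ ∂μ := by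
  rw [setAverage_eq, enorm_smul]
  gcongr
  · rw [Real.enorm_eq_ofReal (by positivity), measureReal_def, ← ENNReal.toReal_inv,
      ENNReal.ofReal_toReal]
    simpa using (measure_ball_pos μ (0 : E) hs).ne'
  · exact enorm_integral_le_lintegral_enorm _

variable [NormedSpace ℝ E]

lemma enorm_sub_le_lintegral_segment {v : E → ℝ} (hv : ContDiff ℝ 1 v) (x z : E) :
    ‖v (x + z) - v x‖ₑ ≤ ∫⁻ t in Set.Icc (0 : ℝ) 1, ‖z‖ₑ * ‖fderiv ℝ v (x + t • z)‖ₑ := by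
  have hcont : Continuous fun t : ℝ => fderiv ℝ v (x + t • z) z := by
    have h1 := hv.continuous_fderiv one_ne_zero
    fun_prop
  have hd : ∀ t : ℝ, HasDerivAt (fun t : ℝ => v (x + t • z)) (fderiv ℝ v (x + t • z) z) t := by
    intro t
    have h2 : HasDerivAt (fun t : ℝ => x + t • z) z t := by
      simpa using ((hasDerivAt_id t).smul_const z).const_add x
    exact ((hv.differentiable one_ne_zero (x + t • z)).hasFDerivAt).comp_hasDerivAt t h2
  have h := intervalIntegral.integral_eq_sub_of_hasDerivAt (a := 0) (b := 1)
    (fun t _ => hd t) (hcont.intervalIntegrable _ _)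
  simp only [one_smul, zero_smul, add_zero] at h
  rw [← h, intervalIntegral.integral_of_le zero_le_one]
  refine (enorm_integral_le_lintegral_enorm _).trans ?_
  rw [← restrict_Ioc_eq_restrict_Icc]
  refine lintegral_mono fun t => ?_
  rw [mul_comm]
  exact ContinuousLinearMap.le_opENorm _ _

variable [FiniteDimensional ℝ E] [MeasurableSpace E] [BorelSpace E]

lemma lintegral_translate_sub_le (μ : Measure E) [μ.IsAddHaarMeasure] {v : E → ℝ}
    (hv : ContDiff ℝ 1 v) (z : E) {S T : Set E} (hS : MeasurableSet S) (hT : MeasurableSet T)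
    (hST : ∀ x ∈ S, ∀ t ∈ Set.Icc (0 : ℝ) 1, x + t • z ∈ T) :
    ∫⁻ x in S, ‖v (x + z) - v x‖ₑ ∂μ ≤ ‖z‖ₑ * ∫⁻ x in T, ‖fderiv ℝ v x‖ₑ ∂μ := by
  have hg : Measurable fun x => ‖fderiv ℝ v x‖ₑ := (measurable_fderiv ℝ v).enorm
  set G : E → ℝ≥0∞ := T.indicator fun x => ‖fderiv ℝ v x‖ₑ with hG
  have hGm : Measurable G := hg.indicator hT
  have hm : Measurable fun p : E × ℝ => G (p.1 + p.2 • z) := hGm.comp (by fun_prop)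
  calc ∫⁻ x in S, ‖v (x + z) - v x‖ₑ ∂μ
      ≤ ∫⁻ x in S, (∫⁻ t in Set.Icc (0 : ℝ) 1, ‖z‖ₑ * G (x + t • z)) ∂μ := by
        refine setLIntegral_mono' hS fun x hx => (enorm_sub_le_lintegral_segment hv x z).trans ?_
        refine (setLIntegral_congr_fun measurableSet_Icc fun t ht => ?_).le
        simp only [hG, Set.indicator_of_mem (hST x hx t ht)]
    _ ≤ ∫⁻ x, (∫⁻ t in Set.Icc (0 : ℝ) 1, ‖z‖ₑ * G (x + t • z)) ∂μ := setLIntegral_le_lintegral _ _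
    _ = ∫⁻ t in Set.Icc (0 : ℝ) 1, (∫⁻ x, ‖z‖ₑ * G (x + t • z) ∂μ) :=
        lintegral_lintegral_swap (hm.const_mul _).aemeasurable
    _ = ∫⁻ t in Set.Icc (0 : ℝ) 1, ‖z‖ₑ * ∫⁻ x in T, ‖fderiv ℝ v x‖ₑ ∂μ := by
        congr 1 with t
        rw [lintegral_const_mul' _ _ enorm_ne_top, lintegral_add_right_eq_self G (t • z), hG,
          lintegral_indicator hT]
    _ = _ := by simp

/-- The mean value of `v` over the ball of radius `s` around `p`, written as an integral over the
centred ball so that its dependence on `p` is by translation of `v`. -/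
noncomputable def ballMean (μ : Measure E) (v : E → ℝ) (s : ℝ) (p : E) : ℝ :=
  ⨍ y in ball (0 : E) s, v (p + y) ∂μ

lemma integrableOn_ball_translate (μ : Measure E) [μ.IsAddHaarMeasure] {v : E → ℝ}
    (hv : Continuous v) (p : E) (s : ℝ) :
    IntegrableOn (fun y => v (p + y)) (ball (0 : E) s) μ :=
  ((by fun_prop : Continuous fun y => v (p + y)).continuousOn.integrableOn_compact
    (isCompact_closedBall 0 s)).mono_set ball_subset_closedBall

lemma enorm_ballMean_sub_le (μ : Measure E) [μ.IsAddHaarMeasure] {v : E → ℝ}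
    (hv : ContDiff ℝ 1 v) {s : ℝ} (hs : 0 < s) {p q : E} (hpq : dist q p ≤ s) :
    ‖ballMean μ v s q - ballMean μ v s p‖ₑ ≤
      (μ (ball 0 s))⁻¹ * (‖q - p‖ₑ * ∫⁻ x in ball p (2 * s), ‖fderiv ℝ v x‖ₑ ∂μ) := by
  have e : ballMean μ v s q - ballMean μ v s p =
      ⨍ y in ball (0 : E) s, (v (q + y) - v (p + y)) ∂μ := by
    simp only [ballMean, setAverage_eq]
    rw [integral_sub (integrableOn_ball_translate μ hv.continuous q s)
      (integrableOn_ball_translate μ hv.continuous p s), smul_sub]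
  rw [e]
  refine (enorm_average_le μ hs _).trans ?_
  gcongr
  have h := lintegral_translate_sub_le μ (v := fun x => v (p + x))
    (hv.comp (contDiff_const.add contDiff_id)) (q - p) (S := ball 0 s) (T := ball 0 (2 * s))
    measurableSet_ball measurableSet_ball (fun x hx t ht => by
      rw [mem_ball_zero_iff] at hx ⊢
      rw [dist_eq_norm] at hpq
      calc ‖x + t • (q - p)‖ ≤ ‖x‖ + ‖t • (q - p)‖ := norm_add_le _ _
        _ = ‖x‖ + t * ‖q - p‖ := by rw [norm_smul, Real.norm_of_nonneg ht.1]
        _ < s + 1 * s := by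
            have := mul_le_mul ht.2 hpq (norm_nonneg _) zero_le_one
            linarith
        _ = 2 * s := by ring)
  calc ∫⁻ y in ball (0 : E) s, ‖v (q + y) - v (p + y)‖ₑ ∂μ
      = ∫⁻ x in ball (0 : E) s, ‖v (p + (x + (q - p))) - v (p + x)‖ₑ ∂μ := by
        congr 1 with y
        congr 3
        abel
    _ ≤ _ := h
    _ = ‖q - p‖ₑ * ∫⁻ x in ball p (2 * s), ‖fderiv ℝ v x‖ₑ ∂μ := by
        congr 1
        simp only [fderiv_comp_add_left]
        rw [← lintegral_indicator measurableSet_ball, ← lintegral_indicator measurableSet_ball,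
          ← lintegral_add_left_eq_self ((ball p (2 * s)).indicator _) p]
        congr 1 with x
        simp [Set.indicator]

lemma continuous_ballMean (μ : Measure E) [μ.IsAddHaarMeasure] {v : E → ℝ}
    (hv : ContDiff ℝ 1 v) {s : ℝ} (hs : 0 < s) : Continuous (ballMean μ v s) := by
  rw [continuous_iff_continuousAt]
  intro p
  set K := (μ (ball (0 : E) s))⁻¹ * ∫⁻ x in ball p (2 * s), ‖fderiv ℝ v x‖ₑ ∂μ with hK
  have hKt : K ≠ ⊤ := by
    refine ENNReal.mul_ne_top (by simpa using (measure_ball_pos μ (0 : E) hs).ne') ?_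
    have hi : IntegrableOn (fderiv ℝ v) (ball p (2 * s)) μ :=
      ((hv.continuous_fderiv one_ne_zero).continuousOn.integrableOn_compact
        (isCompact_closedBall p (2 * s))).mono_set ball_subset_closedBall
    exact hi.2.ne
  rw [ContinuousAt, tendsto_iff_edist_tendsto_0]
  have h0 : Filter.Tendsto (fun q => K * ‖q - p‖ₑ) (nhds p) (nhds 0) := by
    have : Filter.Tendsto (fun q => ‖q - p‖ₑ) (nhds p) (nhds 0) := by
      have hc : Continuous fun q : E => ‖q - p‖ₑ := by fun_prop
      simpa using hc.tendsto p
    simpa using ENNReal.Tendsto.const_mul this (Or.inr hKt)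
  refine tendsto_of_tendsto_of_tendsto_of_le_of_le' tendsto_const_nhds h0
    (Filter.Eventually.of_forall fun _ => zero_le) ?_
  filter_upwards [closedBall_mem_nhds p hs] with q hq
  rw [edist_eq_enorm_sub]
  refine (enorm_ballMean_sub_le μ hv hs hq).trans_eq ?_
  rw [hK]; ring

/-- A Poincaré inequality in a ball, with the gradient integrated over a larger ball. The room
between the balls makes translation invariance of `μ` the only tool needed. -/
lemma lintegral_sub_ballMean_le (μ : Measure E) [μ.IsAddHaarMeasure] {v : E → ℝ}
    (hv : ContDiff ℝ 1 v) {s : ℝ} (hs : 0 < s) (p : E) :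
    ∫⁻ x in ball p s, ‖v x - ballMean μ v s p‖ₑ ∂μ ≤
      2 ^ Module.finrank ℝ E * ENNReal.ofReal (2 * s) *
        ∫⁻ x in ball p (3 * s), ‖fderiv ℝ v x‖ₑ ∂μ := by
  have hvc := hv.continuous
  have hB0 : μ (ball (0 : E) s) ≠ 0 := (measure_ball_pos μ (0 : E) hs).ne'
  have hBt : μ (ball (0 : E) s) ≠ ⊤ := measure_ball_lt_top.ne
  have h1 : ∀ x ∈ ball p s, ‖v x - ballMean μ v s p‖ₑ ≤ (μ (ball 0 s))⁻¹ *
      ∫⁻ z in ball (0 : E) (2 * s), ‖v (x + z) - v x‖ₑ ∂μ := by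
    intro x hx
    have e : ballMean μ v s p - v x = ⨍ y in ball (0 : E) s, (v (p + y) - v x) ∂μ := by
      simp only [ballMean, setAverage_eq]
      rw [integral_sub (integrableOn_ball_translate μ hvc p s)
        (integrableOn_const (by exact hBt) (by simp)), smul_sub]
      congr 1
      rw [setIntegral_const, smul_smul, inv_mul_cancel₀, one_smul]
      exact (ENNReal.toReal_pos hB0 hBt).ne'
    rw [← enorm_neg, neg_sub, e]
    refine (enorm_average_le μ hs _).trans ?_
    refine mul_le_mul_right ?_ _
    rw [← lintegral_indicator measurableSet_ball, ← lintegral_indicator measurableSet_ball,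
      ← lintegral_add_left_eq_self (Set.indicator (ball 0 s) _) (x - p)]
    refine lintegral_mono fun z => ?_
    by_cases hz : x - p + z ∈ ball (0 : E) s
    · rw [Set.indicator_of_mem hz, Set.indicator_of_mem]
      · simp only [← add_assoc, add_sub_cancel, le_refl]
      · rw [mem_ball_zero_iff] at hz ⊢
        rw [mem_ball, dist_eq_norm] at hx
        calc ‖z‖ = ‖(x - p + z) - (x - p)‖ := by congr 1; abel
          _ ≤ ‖x - p + z‖ + ‖x - p‖ := norm_sub_le _ _
          _ < 2 * s := by linarith
    · rw [Set.indicator_of_notMem hz]; exact zero_le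
  have hm : Measurable fun q : E × E => ‖v (q.1 + q.2) - v q.1‖ₑ := by
    have : Continuous fun q : E × E => ‖v (q.1 + q.2) - v q.1‖ₑ := by fun_prop
    exact this.measurable
  calc ∫⁻ x in ball p s, ‖v x - ballMean μ v s p‖ₑ ∂μ
      ≤ ∫⁻ x in ball p s, ((μ (ball 0 s))⁻¹ *
          ∫⁻ z in ball (0 : E) (2 * s), ‖v (x + z) - v x‖ₑ ∂μ) ∂μ :=
        setLIntegral_mono' measurableSet_ball h1
    _ = (μ (ball 0 s))⁻¹ * ∫⁻ z in ball (0 : E) (2 * s),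
          (∫⁻ x in ball p s, ‖v (x + z) - v x‖ₑ ∂μ) ∂μ := by
        rw [lintegral_const_mul' _ _ (by simpa using hB0), lintegral_lintegral_swap hm.aemeasurable]
    _ ≤ (μ (ball 0 s))⁻¹ * ∫⁻ z in ball (0 : E) (2 * s),
          (ENNReal.ofReal (2 * s) * ∫⁻ x in ball p (3 * s), ‖fderiv ℝ v x‖ₑ ∂μ) ∂μ := by
        gcongr (μ (ball 0 s))⁻¹ * ?_
        refine setLIntegral_mono' measurableSet_ball fun z hz => ?_
        rw [mem_ball_zero_iff] at hz
        refine (lintegral_translate_sub_le μ hv z (T := ball p (3 * s)) measurableSet_ball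
          measurableSet_ball fun x hx t ht => ?_).trans ?_
        · rw [mem_ball, dist_eq_norm] at hx ⊢
          calc ‖x + t • z - p‖ = ‖(x - p) + t • z‖ := by congr 1; abel
            _ ≤ ‖x - p‖ + t * ‖z‖ := by
                refine (norm_add_le _ _).trans_eq ?_
                rw [norm_smul, Real.norm_of_nonneg ht.1]
            _ < s + 1 * (2 * s) := by
                have := mul_le_mul ht.2 hz.le (norm_nonneg _) zero_le_one
                linarith
            _ = 3 * s := by ring
        · gcongr
          rw [← ofReal_norm]
          exact ENNReal.ofReal_le_ofReal hz.le
    _ = _ := by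
        rw [setLIntegral_const, Measure.addHaar_ball_mul_of_pos μ 0 zero_lt_two s]
        rw [ENNReal.ofReal_pow zero_le_two, ENNReal.ofReal_ofNat]
        have : (μ (ball (0 : E) s))⁻¹ * μ (ball (0 : E) s) = 1 := ENNReal.inv_mul_cancel hB0 hBt
        calc _ = ((μ (ball (0 : E) s))⁻¹ * μ (ball (0 : E) s)) * (2 ^ Module.finrank ℝ E *
              ENNReal.ofReal (2 * s) * ∫⁻ x in ball p (3 * s), ‖fderiv ℝ v x‖ₑ ∂μ) := by ring
          _ = _ := by rw [this, one_mul]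

/-- The Sobolev–Poincaré inequality for the critical exponent: the Gagliardo–Nirenberg–Sobolev
inequality for a cutoff of `v - ballMean μ v s p`, with the Poincaré inequality for the term in
which the cutoff is differentiated. -/
lemma exists_eLpNorm_sub_ballMean_le (μ : Measure E) [μ.IsAddHaarMeasure] {q : NNReal}
    (hq : NNReal.HolderConjugate (Module.finrank ℝ E) q) :
    ∃ C : ℝ≥0∞, C ≠ ⊤ ∧ ∀ (v : E → ℝ), ContDiff ℝ 1 v → ∀ (s : ℝ), 0 < s → ∀ p : E,
      eLpNorm (fun x => v x - ballMean μ v s p) q (μ.restrict (ball p (s / 2))) ≤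
        C * ∫⁻ x in ball p (3 * s), ‖fderiv ℝ v x‖ₑ ∂μ := by
  let b : ContDiffBump (0 : E) := ⟨1 / 2, 3 / 4, by norm_num, by norm_num⟩
  have hb : ContDiff ℝ 1 b := b.contDiff
  obtain ⟨M, hM⟩ : ∃ M, ∀ x, ‖fderiv ℝ b x‖ ≤ M :=
    (hb.continuous_fderiv one_ne_zero).bounded_above_of_compact_support
      (b.hasCompactSupport.fderiv ℝ)
  have hM0 : 0 ≤ M := (norm_nonneg _).trans (hM 0)
  refine ⟨(eLpNormLESNormFDerivOneConst μ q : ℝ≥0∞) * (1 + ENNReal.ofReal M *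
    (2 ^ Module.finrank ℝ E * 2)), by finiteness, fun v hv s hs p => ?_⟩
  set c := ballMean μ v s p with hc
  set η : E → ℝ := fun x => b (s⁻¹ • (x - p)) with hη
  have hηd : ContDiff ℝ 1 η := hb.comp (by fun_prop)
  have hη1 : ∀ x ∈ ball p (s / 2), η x = 1 := fun x hx => by
    refine b.one_of_mem_closedBall ?_
    rw [mem_closedBall_zero_iff, norm_smul, norm_inv, Real.norm_of_nonneg hs.le,
      ← dist_eq_norm, inv_mul_le_iff₀ hs]
    have := (mem_ball.1 hx).le
    change _ ≤ s * (1 / 2)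
    linarith
  have hη0 : ∀ x, x ∉ ball p (3 / 4 * s) → η x = 0 := fun x hx => by
    refine b.zero_of_le_dist ?_
    rw [dist_zero_right, norm_smul, norm_inv, Real.norm_of_nonneg hs.le, ← dist_eq_norm,
      le_inv_mul_iff₀ hs]
    change s * (3 / 4) ≤ _
    rw [mem_ball, not_lt] at hx
    linarith
  have hηle : ∀ x, ‖η x‖ₑ ≤ 1 := fun x => by
    rw [Real.enorm_eq_ofReal b.nonneg]
    exact ENNReal.ofReal_le_one.2 b.le_one
  have hfη : ∀ x, ‖fderiv ℝ η x‖ₑ ≤ ENNReal.ofReal (M / s) := fun x => by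
    have h1 : HasFDerivAt (fun x : E => s⁻¹ • (x - p)) (s⁻¹ • ContinuousLinearMap.id ℝ E) x :=
      ((hasFDerivAt_id x).sub_const p).const_smul s⁻¹
    have h2 := HasFDerivAt.comp (g := (b : E → ℝ)) x
      (hb.differentiable one_ne_zero (s⁻¹ • (x - p))).hasFDerivAt h1
    rw [show fderiv ℝ η x = _ from h2.fderiv, ← ofReal_norm]
    refine ENNReal.ofReal_le_ofReal ?_
    rw [ContinuousLinearMap.comp_smul, ContinuousLinearMap.comp_id, norm_smul, norm_inv,
      Real.norm_of_nonneg hs.le, div_eq_inv_mul]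
    gcongr
    exact hM _
  set w : E → ℝ := fun x => η x * (v x - c) with hw
  have hwd : ContDiff ℝ 1 w := hηd.mul (hv.sub contDiff_const)
  have hw0 : ∀ x, x ∉ ball p (3 / 4 * s) → w x = 0 := fun x hx => by simp [hw, hη0 x hx]
  have hwc : HasCompactSupport w :=
    HasCompactSupport.intro (isCompact_closedBall p (3 / 4 * s))
      fun x hx => hw0 x fun h => hx (ball_subset_closedBall h)
  have hGNS := eLpNorm_le_eLpNorm_fderiv_one μ hwd hwc hq
  have hfw : ∀ x, ‖fderiv ℝ w x‖ₑ ≤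
      (ball p s).indicator
        (fun x => ‖fderiv ℝ v x‖ₑ + ENNReal.ofReal (M / s) * ‖v x - c‖ₑ) x := by
    intro x
    by_cases hx : x ∈ ball p s
    · rw [Set.indicator_of_mem hx]
      have h2 : HasFDerivAt w _ x := (hηd.differentiable one_ne_zero x).hasFDerivAt.mul
        ((hv.differentiable one_ne_zero x).hasFDerivAt.sub_const c)
      rw [h2.fderiv]
      refine le_trans (enorm_add_le (η x • fderiv ℝ v x) ((v x - c) • fderiv ℝ η x)) ?_
      rw [enorm_smul, enorm_smul, mul_comm ‖v x - c‖ₑ]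
      gcongr
      · exact mul_le_of_le_one_left' (hηle x)
      · exact hfη x
    · have : w =ᶠ[nhds x] fun _ => 0 := by
        have hx' : x ∈ (closedBall p (3 / 4 * s))ᶜ := fun h =>
          hx (closedBall_subset_ball (by linarith) h)
        filter_upwards [isClosed_closedBall.isOpen_compl.mem_nhds hx'] with y hy
        exact hw0 y fun h => hy (ball_subset_closedBall h)
      rw [this.fderiv_eq, Set.indicator_of_notMem hx, fderiv_const_apply, ← ofReal_norm, norm_zero,
        ENNReal.ofReal_zero]
  have hfv : Measurable fun x => ‖fderiv ℝ v x‖ₑ := (measurable_fderiv ℝ v).enorm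
  have hpoin := lintegral_sub_ballMean_le μ hv hs p
  rw [← hc] at hpoin
  have hI : eLpNorm (fderiv ℝ w) 1 μ ≤ (1 + ENNReal.ofReal M * (2 ^ Module.finrank ℝ E * 2)) *
      ∫⁻ x in ball p (3 * s), ‖fderiv ℝ v x‖ₑ ∂μ := by
    rw [eLpNorm_one_eq_lintegral_enorm]
    refine (lintegral_mono hfw).trans ?_
    rw [lintegral_indicator measurableSet_ball, lintegral_add_left hfv,
      lintegral_const_mul' _ _ ENNReal.ofReal_ne_top, add_mul, one_mul]
    refine add_le_add ?_ ?_
    · exact lintegral_mono_set (ball_subset_ball (by linarith))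
    · refine (mul_le_mul_right hpoin _).trans_eq ?_
      rw [← mul_assoc, ENNReal.ofReal_mul zero_le_two, ENNReal.ofReal_ofNat]
      have : ENNReal.ofReal M = ENNReal.ofReal (M / s) * ENNReal.ofReal s := by
        rw [← ENNReal.ofReal_mul (by positivity), div_mul_cancel₀ _ hs.ne']
      rw [this]; ring
  calc eLpNorm (fun x => v x - c) q (μ.restrict (ball p (s / 2)))
      = eLpNorm w q (μ.restrict (ball p (s / 2))) := by
        refine eLpNorm_congr_ae ((ae_restrict_iff' measurableSet_ball).2
          (.of_forall fun x hx => ?_))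
        simp [hw, hη1 x hx]
    _ ≤ eLpNorm w q μ := eLpNorm_mono_measure _ Measure.restrict_le_self
    _ ≤ _ := hGNS
    _ ≤ _ := by rw [mul_assoc]; gcongr

end LocalSobolev

/-! ### Overlap of balls along a cubic lattice -/

section Lattice

variable {n : ℕ}

/-- The integer coordinates of the cell of the cubic lattice of mesh `a` that contains `x`. -/
noncomputable def latticeCell (a : ℝ) (x : EuclideanSpace ℝ (Fin n)) : Fin n → ℤ :=
  fun i => ⌊x i / a⌋

lemma measurable_latticeCell (a : ℝ) :
    Measurable (latticeCell a : EuclideanSpace ℝ (Fin n) → Fin n → ℤ) := by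
  refine measurable_pi_lambda _ fun i => Int.measurable_floor.comp ?_
  exact (by fun_prop : Continuous fun x : EuclideanSpace ℝ (Fin n) => x i / a).measurable

lemma dist_le_of_latticeCell_eq {a : ℝ} (ha : 0 < a) {x y : EuclideanSpace ℝ (Fin n)}
    (h : latticeCell a x = latticeCell a y) : dist x y ≤ n * a := by
  have hi : ∀ i, dist (x i) (y i) ≤ a := fun i => by
    have h1 := Int.abs_sub_lt_one_of_floor_eq_floor (congrFun h i)
    rw [← sub_div, abs_div, abs_of_pos ha, div_lt_one ha] at h1
    exact h1.le
  rw [EuclideanSpace.dist_eq]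
  refine Real.sqrt_le_iff.2 ⟨by positivity, ?_⟩
  calc ∑ i, dist (x i) (y i) ^ 2 ≤ ∑ _i : Fin n, a ^ 2 := by
        gcongr with i
        exact hi i
    _ = n * a ^ 2 := by simp
    _ ≤ n ^ 2 * a ^ 2 := by
        gcongr
        exact_mod_cast Nat.le_self_pow two_ne_zero n
    _ = (n * a) ^ 2 := by ring

/-- Balls of radius `t` around points in distinct cells of mesh `a` overlap boundedly often. -/
lemma tsum_lintegral_ball_le {ι : Type*} [Countable ι] {a t : ℝ} (ha : 0 < a) (L : ℕ)
    (hL : t / a + 1 ≤ L) {p : ι → EuclideanSpace ℝ (Fin n)}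
    (hp : Function.Injective fun k => latticeCell a (p k)) {T : Set (EuclideanSpace ℝ (Fin n))}
    (hT : MeasurableSet T) (hball : ∀ k, ball (p k) t ⊆ T)
    {g : EuclideanSpace ℝ (Fin n) → ℝ≥0∞} (hg : Measurable g) :
    ∑' k, ∫⁻ x in ball (p k) t, g x ≤ (2 * L + 1 : ℕ) ^ n * ∫⁻ x in T, g x := by
  have hpt : ∀ x, ∑' k, (ball (p k) t).indicator g x ≤
      (2 * L + 1 : ℕ) ^ n * T.indicator g x := by
    intro x
    set J : Set ι := {k | x ∈ ball (p k) t} with hJ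
    set S : Finset (Fin n → ℤ) :=
      Fintype.piFinset fun i => Finset.Icc (latticeCell a x i - L) (latticeCell a x i + L)
    have hS : S.card = (2 * L + 1) ^ n := by
      rw [Fintype.card_piFinset]
      have hc : ∀ m : ℤ, (Finset.Icc (m - L) (m + L)).card = 2 * L + 1 := fun m => by
        rw [Int.card_Icc]
        omega
      simp [hc]
    have hJS : ∀ k ∈ J, latticeCell a (p k) ∈ S := by
      intro k hk
      rw [Fintype.mem_piFinset]
      intro i
      have h1 : |x i - p k i| ≤ t := by
        have h2 := PiLp.norm_apply_le (x - p k) i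
        rw [Real.norm_eq_abs, ← dist_eq_norm] at h2
        exact h2.trans (mem_ball.1 hk).le
      have h3 : |x i / a - p k i / a| ≤ L - 1 := by
        rw [← sub_div, abs_div, abs_of_pos ha]
        have : |x i - p k i| / a ≤ t / a := by gcongr
        linarith
      rw [abs_le] at h3
      have f1 := Int.floor_le (x i / a)
      have f2 := Int.lt_floor_add_one (x i / a)
      have f3 := Int.floor_le (p k i / a)
      have f4 := Int.lt_floor_add_one (p k i / a)
      rw [Finset.mem_Icc]
      simp only [latticeCell]
      constructor
      · have : ((⌊x i / a⌋ : ℤ) : ℝ) - L ≤ (⌊p k i / a⌋ : ℤ) := by linarith [h3.2]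
        exact_mod_cast this
      · have : ((⌊p k i / a⌋ : ℤ) : ℝ) ≤ (⌊x i / a⌋ : ℤ) + L := by linarith [h3.1]
        exact_mod_cast this
    have hfin : J.Finite :=
      Set.Finite.of_finite_image (f := fun k => latticeCell a (p k))
        (S.finite_toSet.subset (by rintro _ ⟨k, hk, rfl⟩; exact hJS k hk)) hp.injOn
    rw [tsum_eq_sum (s := hfin.toFinset) fun k hk => Set.indicator_of_notMem
      (by simpa [hJ] using hk) _]
    calc ∑ k ∈ hfin.toFinset, (ball (p k) t).indicator g x
        ≤ ∑ _k ∈ hfin.toFinset, T.indicator g x :=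
          Finset.sum_le_sum fun k _ => Set.indicator_le_indicator_of_subset (hball k)
            (fun _ => zero_le) x
      _ = hfin.toFinset.card * T.indicator g x := by simp
      _ ≤ (2 * L + 1 : ℕ) ^ n * T.indicator g x := by
          gcongr
          have hle : hfin.toFinset.card ≤ (2 * L + 1) ^ n := hS ▸ Finset.card_le_card_of_injOn _
            (fun k hk => hJS k (by simpa using hk)) hp.injOn
          exact_mod_cast hle
  calc ∑' k, ∫⁻ x in ball (p k) t, g x = ∑' k, ∫⁻ x, (ball (p k) t).indicator g x := by
        simp only [lintegral_indicator measurableSet_ball]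
    _ = ∫⁻ x, ∑' k, (ball (p k) t).indicator g x :=
        (lintegral_tsum fun k => (hg.indicator measurableSet_ball).aemeasurable).symm
    _ ≤ ∫⁻ x, (2 * L + 1 : ℕ) ^ n * T.indicator g x := lintegral_mono hpt
    _ = _ := by
        rw [lintegral_const_mul' _ _ (by finiteness), lintegral_indicator hT]

end Lattice

/-! ### Relative Sobolev inequality on a connected set -/

section RelativeSobolev

lemma tsum_rpow_le_rpow_tsum {ι : Type*} {q : ℝ} (hq : 1 ≤ q) (f : ι → ℝ≥0∞) :
    ∑' k, f k ^ q ≤ (∑' k, f k) ^ q := by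
  classical
  rw [ENNReal.tsum_eq_iSup_sum]
  refine iSup_le fun s => ?_
  refine le_trans ?_ (ENNReal.rpow_le_rpow (ENNReal.sum_le_tsum s) (by linarith))
  induction s using Finset.induction_on with
  | empty => simp
  | insert a s ha ih =>
    rw [Finset.sum_insert ha, Finset.sum_insert ha]
    exact (add_le_add_right ih _).trans (ENNReal.add_rpow_le_rpow_add _ _ hq)

variable {n : ℕ}

/-- The relative Sobolev inequality modulo a constant. On each cell of a lattice of mesh comparable
to `s` it is the local Sobolev–Poincaré inequality. The means over different cells are compared
through connectedness of `S`: the image of `S` under the continuous function `ballMean volume v s`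
is an interval, and its length is at most the sum of the diameters of the images of the cells. -/
lemma exists_eLpNorm_sub_const_le (hn : 2 ≤ n) {q : NNReal}
    (hq : NNReal.HolderConjugate (n : NNReal) q) :
    ∃ C : ℝ≥0∞, C ≠ ⊤ ∧ ∀ (v : EuclideanSpace ℝ (Fin n) → ℝ), ContDiff ℝ 1 v →
      ∀ (s ρ : ℝ), 0 < s → s ≤ ρ → ∀ S T : Set (EuclideanSpace ℝ (Fin n)),
        MeasurableSet S → IsPreconnected S → S ⊆ closedBall 0 ρ → MeasurableSet T →
        (∀ p ∈ S, ball p (3 * s) ⊆ T) → ∃ c : ℝ,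
          eLpNorm (fun x => v x - c) q (volume.restrict S) ≤
            C * ENNReal.ofReal (ρ / s) ^ (n - 1) * ∫⁻ x in T, ‖fderiv ℝ v x‖ₑ := by
  have hn0 : (0 : ℝ) < n := by positivity
  have hq1 : (1 : ℝ≥0∞) ≤ q := by exact_mod_cast hq.symm.lt.le
  have hqinv : 1 / (q : ℝ) = (n - 1) / n := by
    have := (Real.holderConjugate_iff.1 hq.coe).2
    rw [NNReal.coe_natCast] at this
    rw [one_div, sub_div, div_self hn0.ne', one_div]
    linarith
  obtain ⟨C₁, hC₁, hSP⟩ := exists_eLpNorm_sub_ballMean_le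
    (volume : Measure (EuclideanSpace ℝ (Fin n))) (q := q) (by simpa using hq)
  set L : ℕ := 12 * n + 1 with hL
  set N : ℝ≥0∞ := ((2 * L + 1 : ℕ) : ℝ≥0∞) ^ n with hN
  set β : ℝ≥0∞ := volume (ball (0 : EuclideanSpace ℝ (Fin n)) 1) with hβ
  have hβ0 : β ≠ 0 := (measure_ball_pos _ _ one_pos).ne'
  have hβt : β ≠ ⊤ := measure_ball_lt_top.ne
  have hvol : ∀ s : ℝ, 0 < s → volume (ball (0 : EuclideanSpace ℝ (Fin n)) s) =
      ENNReal.ofReal s ^ n * β := fun s hs => by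
    have := Measure.addHaar_ball_of_pos (volume : Measure (EuclideanSpace ℝ (Fin n))) 0 hs
    rw [this, finrank_euclideanSpace_fin, ENNReal.ofReal_pow hs.le]
  refine ⟨C₁ * N + 2 * N * β⁻¹ * β ^ (1 / (q : ℝ)), by
    have : β⁻¹ ≠ ⊤ := by simpa using hβ0
    have h2 : N ≠ ⊤ := by finiteness
    finiteness, ?_⟩
  intro v hv s ρ hs hsρ S T hS hSc hSρ hT hST
  rcases S.eq_empty_or_nonempty with rfl | ⟨x₀, hx₀⟩
  · exact ⟨0, by simp⟩
  -- cells of mesh `s / (4 n)` have diameter below `s / 2`, the radius in the local inequality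
  set a : ℝ := s / (4 * n) with ha
  have ha0 : 0 < a := by positivity
  have haL : 3 * s / a + 1 ≤ L := by
    rw [ha, hL]
    push_cast
    have : 3 * s / (s / (4 * n)) = 12 * n := by field_simp; ring
    linarith
  set I : Set (Fin n → ℤ) := latticeCell a '' S with hI
  have hex : ∀ k : I, ∃ x ∈ S, latticeCell a x = k := fun k => k.2
  choose p hpS hpk using hex
  set D : ℝ≥0∞ := ∫⁻ x in T, ‖fderiv ℝ v x‖ₑ with hD
  have hg : Measurable fun x => ‖fderiv ℝ v x‖ₑ := (measurable_fderiv ℝ v).enorm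
  have hsum : ∑' k, ∫⁻ x in ball (p k) (3 * s), ‖fderiv ℝ v x‖ₑ ≤ N * D :=
    tsum_lintegral_ball_le ha0 L haL (p := p)
      (fun k l h => Subtype.ext (by simpa only [hpk] using h)) hT (fun k => hST _ (hpS k)) hg
  set Q : I → Set (EuclideanSpace ℝ (Fin n)) := fun k => S ∩ latticeCell a ⁻¹' {k.1} with hQ
  have hQm : ∀ k, MeasurableSet (Q k) := fun k =>
    hS.inter (measurable_latticeCell a (measurableSet_singleton _))
  have hQd : Pairwise (Function.onFun Disjoint Q) := fun k l hkl =>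
    Set.disjoint_left.2 fun x hx hy => hkl (Subtype.ext (hx.2.symm.trans hy.2))
  have hQU : S = ⋃ k, Q k := by
    ext x
    simp only [hQ, Set.mem_iUnion, Set.mem_inter_iff]
    exact ⟨fun hx => ⟨⟨_, x, hx, rfl⟩, hx, rfl⟩, fun ⟨_, hx, _⟩ => hx⟩
  have hQdist : ∀ k, ∀ x ∈ Q k, dist x (p k) < s / 2 := fun k x hx => by
    have h1 : latticeCell a x = latticeCell a (p k) := by rw [hpk]; exact hx.2
    refine (dist_le_of_latticeCell_eq ha0 h1).trans_lt ?_
    rw [ha, show (n : ℝ) * (s / (4 * n)) = s / 4 by field_simp]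
    linarith
  set w := ballMean (volume : Measure (EuclideanSpace ℝ (Fin n))) v s with hw
  have hwc : Continuous w := continuous_ballMean _ hv hs
  set κ : ℝ≥0∞ := (volume (ball (0 : EuclideanSpace ℝ (Fin n)) s))⁻¹ * ENNReal.ofReal s with hκ
  have hwQ : ∀ k, ∀ x ∈ Q k, edist (w x) (w (p k)) ≤
      κ * ∫⁻ x in ball (p k) (3 * s), ‖fderiv ℝ v x‖ₑ := fun k x hx => by
    have hd := hQdist k x hx
    rw [edist_eq_enorm_sub, hκ, mul_assoc]
    refine (enorm_ballMean_sub_le volume hv hs (by linarith : dist x (p k) ≤ s)).trans ?_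
    refine mul_le_mul_right (mul_le_mul' ?_ (lintegral_mono_set (ball_subset_ball (by linarith)))) _
    rw [← ofReal_norm, ← dist_eq_norm]
    exact ENNReal.ofReal_le_ofReal (by linarith)
  have hosc : ∀ x ∈ S, ∀ y ∈ S, ‖w x - w y‖ₑ ≤ 2 * (κ * (N * D)) := by
    intro x hx y hy
    have hvolI : volume (w '' S) ≤ 2 * (κ * (N * D)) := by
      calc volume (w '' S) = volume (⋃ k, w '' Q k) := by
            conv_lhs => rw [hQU, Set.image_iUnion]
        _ ≤ ∑' k, volume (w '' Q k) := measure_iUnion_le _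
        _ ≤ ∑' k, 2 * (κ * ∫⁻ x in ball (p k) (3 * s), ‖fderiv ℝ v x‖ₑ) := by
            refine ENNReal.tsum_le_tsum fun k => (Real.volume_le_diam _).trans ?_
            refine ediam_le ?_
            rintro _ ⟨y, hy, rfl⟩ _ ⟨z, hz, rfl⟩
            refine (edist_triangle_right _ _ (w (p k))).trans ?_
            rw [two_mul]
            exact add_le_add (hwQ k y hy) (hwQ k z hz)
        _ = 2 * (κ * ∑' k, ∫⁻ x in ball (p k) (3 * s), ‖fderiv ℝ v x‖ₑ) := by
            rw [ENNReal.tsum_mul_left, ENNReal.tsum_mul_left]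
        _ ≤ _ := by gcongr
    have hsub : Set.uIcc (w y) (w x) ⊆ w '' S :=
      ((hSc.image w hwc.continuousOn).ordConnected).uIcc_subset ⟨y, hy, rfl⟩ ⟨x, hx, rfl⟩
    calc ‖w x - w y‖ₑ = volume (Set.uIcc (w y) (w x)) := by
          rw [Real.volume_interval, Real.enorm_eq_ofReal_abs]
      _ ≤ _ := (measure_mono hsub).trans hvolI
  refine ⟨w x₀, ?_⟩
  -- the mean over the cell of `x`, as a measurable step function
  classical
  set W : EuclideanSpace ℝ (Fin n) → ℝ := fun x =>
    (fun k : Fin n → ℤ => if h : k ∈ I then w (p ⟨k, h⟩) else w x₀) (latticeCell a x) with hW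
  have hWm : Measurable W := Measurable.comp
    (g := fun k : Fin n → ℤ => if h : k ∈ I then w (p ⟨k, h⟩) else w x₀)
    (measurable_of_countable _) (measurable_latticeCell a)
  have hWQ : ∀ k, ∀ x ∈ Q k, W x = w (p k) := by
    rintro ⟨k, hk⟩ x ⟨-, rfl⟩
    simp only [hW, hk, dite_true]
  have h1 : eLpNorm (fun x => v x - W x) q (volume.restrict S) ≤ C₁ * (N * D) := by
    have hpow : ∀ k, ∫⁻ x in Q k, ‖v x - W x‖ₑ ^ (q : ℝ) ≤
        (C₁ * ∫⁻ x in ball (p k) (3 * s), ‖fderiv ℝ v x‖ₑ) ^ (q : ℝ) := by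
      intro k
      have h2 := hSP v hv s hs (p k)
      have h3 : eLpNorm (fun x => v x - W x) q (volume.restrict (Q k)) ≤
          C₁ * ∫⁻ x in ball (p k) (3 * s), ‖fderiv ℝ v x‖ₑ := by
        refine le_trans ?_ h2
        rw [eLpNorm_congr_ae (g := fun x => v x - w (p k)) ((ae_restrict_iff' (hQm k)).2
          (.of_forall fun x hx => by simp only [hWQ k x hx]))]
        exact eLpNorm_mono_measure _ (Measure.restrict_mono (fun x hx => hQdist k x hx) le_rfl)
      rw [← eLpNorm_nnreal_pow_eq_lintegral hq.symm.pos.ne']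
      gcongr
    rw [← ENNReal.rpow_le_rpow_iff (z := (q : ℝ)) hq.symm.coe.pos,
      eLpNorm_nnreal_pow_eq_lintegral hq.symm.pos.ne']
    calc ∫⁻ x in S, ‖v x - W x‖ₑ ^ (q : ℝ) = ∑' k, ∫⁻ x in Q k, ‖v x - W x‖ₑ ^ (q : ℝ) := by
          conv_lhs => rw [hQU, lintegral_iUnion hQm hQd]
      _ ≤ ∑' k, (C₁ * ∫⁻ x in ball (p k) (3 * s), ‖fderiv ℝ v x‖ₑ) ^ (q : ℝ) :=
          ENNReal.tsum_le_tsum hpow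
      _ ≤ (∑' k, C₁ * ∫⁻ x in ball (p k) (3 * s), ‖fderiv ℝ v x‖ₑ) ^ (q : ℝ) :=
          tsum_rpow_le_rpow_tsum (by exact_mod_cast hq1) _
      _ ≤ (C₁ * (N * D)) ^ (q : ℝ) := by
          rw [ENNReal.tsum_mul_left]
          gcongr
  have h2 : eLpNorm (fun x => W x - w x₀) q (volume.restrict S) ≤
      2 * (κ * (N * D)) * volume S ^ (1 / (q : ℝ)) := by
    refine (eLpNorm_le_of_ae_enorm_bound (C := 2 * (κ * (N * D)))
      ((ae_restrict_iff' hS).2 (.of_forall fun x hx => ?_))).trans_eq ?_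
    · have hk : x ∈ Q ⟨latticeCell a x, x, hx, rfl⟩ := ⟨hx, rfl⟩
      rw [hWQ _ x hk]
      exact hosc _ (hpS _) _ hx₀
    · simp
  have hvS : volume S ≤ ENNReal.ofReal ρ ^ n * β := by
    refine (measure_mono hSρ).trans ?_
    rw [Measure.addHaar_closedBall _ _ (hs.le.trans hsρ), finrank_euclideanSpace_fin,
      ENNReal.ofReal_pow (hs.le.trans hsρ)]
  have h3 : κ * volume S ^ (1 / (q : ℝ)) ≤
      β⁻¹ * β ^ (1 / (q : ℝ)) * ENNReal.ofReal (ρ / s) ^ (n - 1) := by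
    have hs0 : ENNReal.ofReal s ≠ 0 := by simpa using hs
    have e1 : (ENNReal.ofReal ρ ^ n * β) ^ (1 / (q : ℝ)) =
        ENNReal.ofReal ρ ^ (n - 1) * β ^ (1 / (q : ℝ)) := by
      rw [ENNReal.mul_rpow_of_nonneg _ _ (by positivity)]
      congr 1
      rw [← ENNReal.rpow_natCast, ← ENNReal.rpow_mul, hqinv, mul_div_cancel₀ _ hn0.ne',
        ← ENNReal.rpow_natCast, Nat.cast_sub (by omega), Nat.cast_one]
    have e2 : κ = β⁻¹ * (ENNReal.ofReal s ^ (n - 1))⁻¹ := by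
      obtain ⟨m, rfl⟩ : ∃ m, n = m + 1 := ⟨n - 1, by omega⟩
      rw [hκ, hvol s hs, Nat.add_sub_cancel,
        ENNReal.mul_inv (Or.inr hβt) (Or.inr hβ0), pow_succ,
        ENNReal.mul_inv (Or.inr ENNReal.ofReal_ne_top) (Or.inr hs0)]
      calc _ = (ENNReal.ofReal s)⁻¹ * ENNReal.ofReal s *
            (β⁻¹ * (ENNReal.ofReal s ^ m)⁻¹) := by ring
        _ = _ := by rw [ENNReal.inv_mul_cancel hs0 ENNReal.ofReal_ne_top, one_mul]
    calc κ * volume S ^ (1 / (q : ℝ)) ≤ κ * (ENNReal.ofReal ρ ^ n * β) ^ (1 / (q : ℝ)) := by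
          gcongr
      _ = _ := by
          rw [e1, e2, ENNReal.ofReal_div_of_pos hs, ENNReal.div_eq_inv_mul, mul_pow,
            ENNReal.inv_pow]
          ring
  calc eLpNorm (fun x => v x - w x₀) q (volume.restrict S)
      = eLpNorm ((fun x => v x - W x) + fun x => W x - w x₀) q (volume.restrict S) := by
        congr 1 with x
        simp
    _ ≤ C₁ * (N * D) + 2 * (κ * (N * D)) * volume S ^ (1 / (q : ℝ)) :=
        (eLpNorm_add_le (hv.continuous.measurable.sub hWm).aestronglyMeasurable
          (hWm.sub_const _).aestronglyMeasurable hq1).trans (add_le_add h1 h2)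
    _ = C₁ * N * 1 * D + 2 * N * (κ * volume S ^ (1 / (q : ℝ))) * D := by ring
    _ ≤ C₁ * N * ENNReal.ofReal (ρ / s) ^ (n - 1) * D +
          2 * N * (β⁻¹ * β ^ (1 / (q : ℝ)) * ENNReal.ofReal (ρ / s) ^ (n - 1)) * D := by
        gcongr
        refine one_le_pow₀ ?_
        rw [ENNReal.one_le_ofReal, one_le_div hs]
        exact hsρ
    _ = _ := by ring

/-- The relative Sobolev inequality for a function that vanishes on a substantial part of `S`:
the zero set controls the constant left free by `exists_eLpNorm_sub_const_le`. -/
lemma exists_eLpNorm_le_of_volume_zeroSet (hn : 2 ≤ n) {q : NNReal}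
    (hq : NNReal.HolderConjugate (n : NNReal) q) :
    ∃ C : ℝ≥0∞, C ≠ ⊤ ∧ ∀ (v : EuclideanSpace ℝ (Fin n) → ℝ), ContDiff ℝ 1 v →
      ∀ (s r ρ : ℝ), 0 < s → s ≤ ρ → 0 < r → r ≤ ρ → ∀ S T : Set (EuclideanSpace ℝ (Fin n)),
        MeasurableSet S → IsPreconnected S → S ⊆ closedBall 0 ρ → MeasurableSet T →
        (∀ p ∈ S, ball p (3 * s) ⊆ T) →
        volume (ball (0 : EuclideanSpace ℝ (Fin n)) r) ≤ 2 ^ (n + 1) * volume (S ∩ v ⁻¹' {0}) →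
          eLpNorm v q (volume.restrict S) ≤
            C * ENNReal.ofReal (ρ ^ 2 / (r * s)) ^ (n - 1) * ∫⁻ x in T, ‖fderiv ℝ v x‖ₑ := by
  have hn0 : (0 : ℝ) < n := by positivity
  have hq0 : (q : ℝ≥0∞) ≠ 0 := by simpa using hq.symm.pos.ne'
  have hq1 : (1 : ℝ≥0∞) ≤ q := by exact_mod_cast hq.symm.lt.le
  have hqinv : 1 / (q : ℝ) = (n - 1) / n := by
    have := (Real.holderConjugate_iff.1 hq.coe).2
    rw [NNReal.coe_natCast] at this
    rw [one_div, sub_div, div_self hn0.ne', one_div]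
    linarith
  obtain ⟨C, hC, hmain⟩ := exists_eLpNorm_sub_const_le hn hq
  set κ : ℝ≥0∞ := (2 ^ (n + 1)) ^ (1 / (q : ℝ)) with hκ
  refine ⟨C * (1 + κ), by finiteness, ?_⟩
  intro v hv s r ρ hs hsρ hr hrρ S T hS hSc hSρ hT hST hZ
  have hρ : 0 < ρ := hr.trans_le hrρ
  obtain ⟨c, hc⟩ := hmain v hv s ρ hs hsρ S T hS hSc hSρ hT hST
  set D : ℝ≥0∞ := ∫⁻ x in T, ‖fderiv ℝ v x‖ₑ
  set A := eLpNorm (fun x => v x - c) q (volume.restrict S) with hA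
  set Z := S ∩ v ⁻¹' {0} with hZdef
  have hZm : MeasurableSet Z := hS.inter (hv.continuous.measurable (measurableSet_singleton 0))
  have hcZ : ‖c‖ₑ * volume Z ^ (1 / (q : ℝ)) ≤ A := by
    calc ‖c‖ₑ * volume Z ^ (1 / (q : ℝ)) = eLpNorm (fun _ => c) q (volume.restrict Z) := by
          rw [eLpNorm_const' c hq0 ENNReal.coe_ne_top]
          simp
      _ = eLpNorm (fun x => v x - c) q (volume.restrict Z) := by
          rw [← eLpNorm_neg]
          refine eLpNorm_congr_ae ((ae_restrict_iff' hZm).2 (.of_forall fun x hx => ?_))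
          have : v x = 0 := hx.2
          simp [this]
      _ ≤ A := eLpNorm_mono_measure _ (Measure.restrict_mono Set.inter_subset_left le_rfl)
  have hvS : volume S ^ (1 / (q : ℝ)) ≤
      ENNReal.ofReal (ρ / r) ^ (n - 1) * (κ * volume Z ^ (1 / (q : ℝ))) := by
    have h1 : volume S ≤ ENNReal.ofReal (ρ / r) ^ n * (2 ^ (n + 1) * volume Z) := by
      calc volume S ≤ volume (closedBall (0 : EuclideanSpace ℝ (Fin n)) ρ) := measure_mono hSρ
        _ = volume (ball (0 : EuclideanSpace ℝ (Fin n)) (ρ / r * r)) := by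
            rw [div_mul_cancel₀ _ hr.ne', Measure.addHaar_closedBall _ _ hρ.le,
              Measure.addHaar_ball_of_pos _ _ hρ]
        _ ≤ _ := by
            rw [Measure.addHaar_ball_mul_of_pos _ _ (by positivity), finrank_euclideanSpace_fin,
              ENNReal.ofReal_pow (by positivity)]
            gcongr
    calc volume S ^ (1 / (q : ℝ))
        ≤ (ENNReal.ofReal (ρ / r) ^ n * (2 ^ (n + 1) * volume Z)) ^ (1 / (q : ℝ)) := by gcongr
      _ = _ := by
          rw [ENNReal.mul_rpow_of_nonneg _ _ (by positivity),
            ENNReal.mul_rpow_of_nonneg _ _ (by positivity)]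
          congr 1
          rw [← ENNReal.rpow_natCast, ← ENNReal.rpow_mul, hqinv, mul_div_cancel₀ _ hn0.ne',
            ← ENNReal.rpow_natCast, Nat.cast_sub (by omega), Nat.cast_one]
  have h1 : 1 ≤ ENNReal.ofReal (ρ / r) ^ (n - 1) := by
    refine one_le_pow₀ ?_
    rw [ENNReal.one_le_ofReal, one_le_div hr]
    exact hrρ
  calc eLpNorm v q (volume.restrict S)
      = eLpNorm ((fun x => v x - c) + fun _ => c) q (volume.restrict S) := by
        congr 1 with x
        simp
    _ ≤ A + eLpNorm (fun _ => c) q (volume.restrict S) :=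
        eLpNorm_add_le (hv.continuous.measurable.sub_const c).aestronglyMeasurable
          aestronglyMeasurable_const hq1
    _ = A + ‖c‖ₑ * volume S ^ (1 / (q : ℝ)) := by
        rw [eLpNorm_const' c hq0 ENNReal.coe_ne_top]
        simp
    _ ≤ A + ‖c‖ₑ * (ENNReal.ofReal (ρ / r) ^ (n - 1) * (κ * volume Z ^ (1 / (q : ℝ)))) := by
        gcongr
    _ = 1 * A + ENNReal.ofReal (ρ / r) ^ (n - 1) * κ * (‖c‖ₑ * volume Z ^ (1 / (q : ℝ))) := by
        ring
    _ ≤ ENNReal.ofReal (ρ / r) ^ (n - 1) * A + ENNReal.ofReal (ρ / r) ^ (n - 1) * κ * A := by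
        gcongr
    _ = (1 + κ) * ENNReal.ofReal (ρ / r) ^ (n - 1) * A := by ring
    _ ≤ (1 + κ) * ENNReal.ofReal (ρ / r) ^ (n - 1) *
          (C * ENNReal.ofReal (ρ / s) ^ (n - 1) * D) := by gcongr
    _ = C * (1 + κ) * (ENNReal.ofReal (ρ / r) * ENNReal.ofReal (ρ / s)) ^ (n - 1) * D := by
        rw [mul_pow]; ring
    _ = _ := by
        rw [← ENNReal.ofReal_mul (by positivity), div_mul_div_comm, ← sq]

end RelativeSobolev

/-! ### Comparison of the induced metric with the rotated Euclidean metric -/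

section RotatedMetric

lemma isHermitian_of_posSemidef_sub_smul_one {ι : Type*} [DecidableEq ι] {κ : ℝ} {H : Matrix ι ι ℝ}
    (hH : (H - κ • 1).PosSemidef) : H.IsHermitian := by
  have h1 : (κ • (1 : Matrix ι ι ℝ)).IsHermitian := by
    simp [Matrix.IsHermitian]
  simpa using hH.isHermitian.add h1

variable {ι : Type*} [Fintype ι] [DecidableEq ι]

/-- The Jacobian matrix of the rotated coordinates `x̄ = cos θ x + sin θ Du(x)`, for `H = D²u`. -/
noncomputable def rotatedJacobian (θ : ℝ) (H : Matrix ι ι ℝ) : Matrix ι ι ℝ :=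
  Real.cos θ • 1 + Real.sin θ • H

lemma cos_half_sub_sin_half_mul_cot {δ : ℝ} (h0 : 0 < δ) (hπ : δ < Real.pi / 2) :
    1 / 2 ≤ Real.cos (δ / 2) - Real.sin (δ / 2) * Real.cot δ := by
  have hs : 0 < Real.sin (δ / 2) := Real.sin_pos_of_pos_of_lt_pi (by linarith) (by linarith)
  have hc : 0 < Real.cos (δ / 2) := Real.cos_pos_of_mem_Ioo ⟨by linarith, by linarith⟩
  have e1 : Real.sin δ = 2 * Real.sin (δ / 2) * Real.cos (δ / 2) := by
    rw [← Real.sin_two_mul]; ring_nf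
  have e2 : Real.cos δ = 2 * Real.cos (δ / 2) ^ 2 - 1 := by
    rw [← Real.cos_two_mul]; ring_nf
  have h1 : Real.cos (δ / 2) - Real.sin (δ / 2) * Real.cot δ = 1 / (2 * Real.cos (δ / 2)) := by
    rw [Real.cot_eq_cos_div_sin, e1, e2]
    field_simp
    ring
  rw [h1]
  exact one_div_le_one_div_of_le (by positivity) (by linarith [Real.cos_le_one (δ / 2)])

lemma half_mul_le_dotProduct_rotatedJacobian {δ : ℝ} (h0 : 0 < δ) (hπ : δ < Real.pi / 2)
    {H : Matrix ι ι ℝ} (hH : (H - (-Real.cot δ) • 1).PosSemidef) (y : ι → ℝ) :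
    1 / 2 * (y ⬝ᵥ y) ≤ y ⬝ᵥ (rotatedJacobian (δ / 2) H *ᵥ y) := by
  have hs : 0 < Real.sin (δ / 2) := Real.sin_pos_of_pos_of_lt_pi (by linarith) (by linarith)
  have h1 := hH.dotProduct_mulVec_nonneg y
  have h2 := cos_half_sub_sin_half_mul_cot h0 hπ
  have hy : 0 ≤ y ⬝ᵥ y := Finset.sum_nonneg fun i _ => mul_self_nonneg (y i)
  simp only [star_trivial, Matrix.sub_mulVec, Matrix.smul_mulVec, Matrix.one_mulVec,
    dotProduct_sub, dotProduct_smul, smul_eq_mul] at h1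
  simp only [rotatedJacobian, Matrix.add_mulVec, Matrix.smul_mulVec, Matrix.one_mulVec,
    dotProduct_add, dotProduct_smul, smul_eq_mul]
  nlinarith

/-- Every matrix built from `H` in the comparison of the metrics is diagonal in an orthonormal
eigenbasis of `H`. -/
lemma exists_orthogonal_diagonalization {κ : ℝ} {H : Matrix ι ι ℝ}
    (hH : (H - (-κ) • 1).PosSemidef) :
    ∃ (U : Matrix ι ι ℝ) (l : ι → ℝ), U * Uᵀ = 1 ∧ Uᵀ * U = 1 ∧
      H = U * Matrix.diagonal l * Uᵀ ∧ ∀ i, -κ ≤ l i := by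
  have hHerm := isHermitian_of_posSemidef_sub_smul_one hH
  refine ⟨hHerm.eigenvectorUnitary, hHerm.eigenvalues, ?_, ?_, ?_, fun i => ?_⟩
  · exact Unitary.mul_star_self_of_mem hHerm.eigenvectorUnitary.2
  · exact Unitary.star_mul_self_of_mem hHerm.eigenvectorUnitary.2
  · conv_lhs => rw [hHerm.spectral_theorem]
    rfl
  · have h1 := hH.dotProduct_mulVec_nonneg (hHerm.eigenvectorBasis i)
    simp only [star_trivial, Matrix.sub_mulVec, Matrix.smul_mulVec, Matrix.one_mulVec,
      dotProduct_sub, dotProduct_smul, smul_eq_mul, hHerm.mulVec_eigenvectorBasis] at h1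
    have h2 : (hHerm.eigenvectorBasis i).ofLp ⬝ᵥ (hHerm.eigenvectorBasis i).ofLp = 1 := by
      have h3 := EuclideanSpace.norm_sq_eq (hHerm.eigenvectorBasis i)
      rw [hHerm.eigenvectorBasis.orthonormal.1 i, one_pow] at h3
      rw [h3]
      exact Finset.sum_congr rfl fun j _ => by rw [Real.norm_eq_abs, sq_abs, sq]
    rw [h2] at h1
    linarith

/-- Comparison of the induced metric `1 + H ^ 2` with the Euclidean metric in the coordinates
rotated by `δ / 2`. With `c = cos (δ / 2)`, `s = sin (δ / 2)`, an eigenvalue `l ≥ -cot δ` of `H`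
satisfies `s² (1 + l²) ≤ (c + s l)² ≤ 1 + l²`. -/
lemma rotatedJacobian_metric_comparison {δ : ℝ} (h0 : 0 < δ) (hπ : δ < Real.pi / 2)
    {H : Matrix ι ι ℝ} (hH : (H - (-Real.cot δ) • 1).PosSemidef) :
    (1 / 2) ^ Fintype.card ι ≤ (rotatedJacobian (δ / 2) H).det ∧
    √(1 + H ^ 2).det ≤ (1 / Real.sin (δ / 2)) ^ Fintype.card ι * (rotatedJacobian (δ / 2) H).det ∧
    ∀ y : ι → ℝ, √(y ⬝ᵥ y) * (rotatedJacobian (δ / 2) H).det ≤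
      √((rotatedJacobian (δ / 2) H *ᵥ y) ⬝ᵥ
        ((1 + H ^ 2)⁻¹ *ᵥ (rotatedJacobian (δ / 2) H *ᵥ y))) * √(1 + H ^ 2).det := by
  obtain ⟨U, l, hUU, hUU', hHU, hl⟩ := exists_orthogonal_diagonalization hH
  set c := Real.cos (δ / 2) with hc
  set s := Real.sin (δ / 2) with hs
  have hs0 : 0 < s := Real.sin_pos_of_pos_of_lt_pi (by linarith) (by linarith)
  have hc0 : 0 < c := Real.cos_pos_of_mem_Ioo ⟨by linarith, by linarith⟩
  have hcs : s ^ 2 + c ^ 2 = 1 := Real.sin_sq_add_cos_sq _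
  have hb := cos_half_sub_sin_half_mul_cot h0 hπ
  have hcot : Real.cot δ * (2 * s * c) = c ^ 2 - s ^ 2 := by
    have e1 : Real.sin δ = 2 * s * c := by
      rw [hs, hc, ← Real.sin_two_mul]; ring_nf
    have e2 : Real.cos δ = c ^ 2 - s ^ 2 := by
      rw [hs, hc, ← Real.cos_two_mul']; ring_nf
    rw [Real.cot_eq_cos_div_sin, e1, e2]
    field_simp
  have hm : ∀ i, 1 / 2 ≤ c + s * l i := fun i => by nlinarith [hl i]
  have hm0 : ∀ i, 0 < c + s * l i := fun i => by linarith [hm i]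
  have hlow : ∀ i, s ^ 2 * (1 + l i ^ 2) ≤ (c + s * l i) ^ 2 := fun i => by
    nlinarith [mul_le_mul_of_nonneg_left (hl i) (by positivity : 0 ≤ 2 * s * c)]
  have hup : ∀ i, (c + s * l i) ^ 2 ≤ 1 + l i ^ 2 := fun i => by
    nlinarith [sq_nonneg (c * l i - s)]
  have hg0 : ∀ i, 0 < 1 + l i ^ 2 := fun i => by positivity
  have hdetU : U.det * U.det = 1 := by
    have := congrArg Matrix.det hUU
    rwa [Matrix.det_mul, Matrix.det_transpose, Matrix.det_one] at this
  have hconj : ∀ d : ι → ℝ, (U * Matrix.diagonal d * Uᵀ).det = ∏ i, d i := fun d => by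
    rw [Matrix.det_mul, Matrix.det_mul, Matrix.det_transpose, Matrix.det_diagonal]
    calc U.det * (∏ i, d i) * U.det = U.det * U.det * ∏ i, d i := by ring
      _ = _ := by rw [hdetU, one_mul]
  have hmul : ∀ d e : ι → ℝ, (U * Matrix.diagonal d * Uᵀ) * (U * Matrix.diagonal e * Uᵀ) =
      U * Matrix.diagonal (fun i => d i * e i) * Uᵀ := fun d e => by
    calc _ = U * Matrix.diagonal d * (Uᵀ * U) * Matrix.diagonal e * Uᵀ := by
          simp only [Matrix.mul_assoc]
      _ = _ := by rw [hUU', Matrix.mul_one, Matrix.mul_assoc U, Matrix.diagonal_mul_diagonal]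
  have hone : (1 : Matrix ι ι ℝ) = U * Matrix.diagonal (fun _ => 1) * Uᵀ := by
    rw [Matrix.diagonal_one, Matrix.mul_one, hUU]
  have hA : rotatedJacobian (δ / 2) H = U * Matrix.diagonal (fun i => c + s * l i) * Uᵀ := by
    have : Matrix.diagonal (fun i => c + s * l i) = c • 1 + s • Matrix.diagonal l := by
      ext i j
      by_cases hij : i = j <;> simp [hij]
    rw [this, Matrix.mul_add, Matrix.add_mul, Matrix.mul_smul, Matrix.mul_one, Matrix.smul_mul,
      hUU, Matrix.mul_smul, Matrix.smul_mul, ← hHU, rotatedJacobian]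
  have hg : 1 + H ^ 2 = U * Matrix.diagonal (fun i => 1 + l i ^ 2) * Uᵀ := by
    have : Matrix.diagonal (fun i => 1 + l i ^ 2) =
        Matrix.diagonal (fun _ => 1) + Matrix.diagonal (fun i => l i * l i) := by
      rw [Matrix.diagonal_add]
      simp only [sq]
    rw [this, Matrix.mul_add, Matrix.add_mul, ← hone, ← hmul, ← hHU, sq]
  have hginv : (1 + H ^ 2)⁻¹ = U * Matrix.diagonal (fun i => (1 + l i ^ 2)⁻¹) * Uᵀ := by
    refine Matrix.inv_eq_right_inv ?_
    rw [hg, hmul]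
    simp only [mul_inv_cancel₀ (hg0 _).ne']
    exact hone.symm
  have hdetA : (rotatedJacobian (δ / 2) H).det = ∏ i, (c + s * l i) := by rw [hA, hconj]
  have hdetg : (1 + H ^ 2).det = ∏ i, (1 + l i ^ 2) := by rw [hg, hconj]
  have hAnn : 0 ≤ ∏ i, (c + s * l i) := Finset.prod_nonneg fun i _ => (hm0 i).le
  refine ⟨?_, ?_, fun y => ?_⟩
  · rw [hdetA]
    calc (1 / 2 : ℝ) ^ Fintype.card ι = ∏ _i : ι, (1 / 2 : ℝ) := by simp
      _ ≤ _ := Finset.prod_le_prod (fun _ _ => by norm_num) fun i _ => hm i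
  · rw [hdetA, hdetg]
    refine Real.sqrt_le_iff.2 ⟨by positivity, ?_⟩
    calc ∏ i, (1 + l i ^ 2) ≤ ∏ i, (1 / s * (c + s * l i)) ^ 2 := by
          refine Finset.prod_le_prod (fun i _ => (hg0 i).le) fun i _ => ?_
          rw [mul_pow, div_pow, one_pow, one_div, inv_mul_eq_div, le_div_iff₀ (by positivity)]
          linarith [hlow i]
      _ = _ := by
          rw [Finset.prod_pow, Finset.prod_mul_distrib, Finset.prod_const, Finset.card_univ]
  · set z := Uᵀ *ᵥ y with hz
    have hquad : ∀ d : ι → ℝ, y ⬝ᵥ ((U * Matrix.diagonal d * Uᵀ) *ᵥ y) = ∑ i, d i * z i ^ 2 := by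
      intro d
      rw [← Matrix.mulVec_mulVec, ← Matrix.mulVec_mulVec, Matrix.dotProduct_mulVec,
        ← Matrix.mulVec_transpose, ← hz]
      simp only [dotProduct, Matrix.mulVec_diagonal]
      exact Finset.sum_congr rfl fun i _ => by ring
    have hyy : y ⬝ᵥ y = ∑ i, z i ^ 2 := by
      have := hquad fun _ => 1
      rw [← hone, Matrix.one_mulVec] at this
      simpa using this
    have hAT : (rotatedJacobian (δ / 2) H)ᵀ = rotatedJacobian (δ / 2) H := by
      rw [hA]
      simp [Matrix.transpose_mul, Matrix.mul_assoc]
    have hAgA : (rotatedJacobian (δ / 2) H *ᵥ y) ⬝ᵥ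
        ((1 + H ^ 2)⁻¹ *ᵥ (rotatedJacobian (δ / 2) H *ᵥ y)) =
          ∑ i, (c + s * l i) ^ 2 * (1 + l i ^ 2)⁻¹ * z i ^ 2 := by
      rw [← Matrix.vecMul_transpose, hAT, ← Matrix.dotProduct_mulVec,
        ← Matrix.mulVec_transpose, hAT, Matrix.mulVec_mulVec, Matrix.mulVec_mulVec, hginv, hA,
        hmul, hmul, hquad]
      exact Finset.sum_congr rfl fun i _ => by ring
    rw [hAgA, hdetA, hdetg, hyy, ← Real.sqrt_sq hAnn, ← Real.sqrt_mul (by positivity),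
      ← Real.sqrt_mul (by positivity)]
    refine Real.sqrt_le_sqrt ?_
    rw [Finset.sum_mul, Finset.sum_mul]
    refine Finset.sum_le_sum fun i _ => ?_
    -- all but the `i`-th factor of the two determinants are compared
    have herase : ∏ j ∈ Finset.univ.erase i, (c + s * l j) ^ 2 ≤
        ∏ j ∈ Finset.univ.erase i, (1 + l j ^ 2) :=
      Finset.prod_le_prod (fun j _ => sq_nonneg _) fun j _ => hup j
    rw [← Finset.prod_pow,
      ← Finset.mul_prod_erase _ (fun j => (c + s * l j) ^ 2) (Finset.mem_univ i),
      ← Finset.mul_prod_erase _ (fun j => 1 + l j ^ 2) (Finset.mem_univ i)]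
    calc z i ^ 2 * ((c + s * l i) ^ 2 * ∏ j ∈ Finset.univ.erase i, (c + s * l j) ^ 2)
        ≤ z i ^ 2 * ((c + s * l i) ^ 2 * ∏ j ∈ Finset.univ.erase i, (1 + l j ^ 2)) := by gcongr
      _ = _ := by
          have := (hg0 i).ne'
          field_simp

end RotatedMetric

/-! ### Expanding maps and the rotated coordinates -/

section ExpandingMap

variable {E : Type*} [NormedAddCommGroup E] [NormedSpace ℝ E] [FiniteDimensional ℝ E]

lemma isOpen_image_of_det_fderiv_ne_zero {F : E → E} {U : Set E} (hU : IsOpen U)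
    (hF : ContDiffOn ℝ 1 F U) (hdet : ∀ x ∈ U, (fderiv ℝ F x).det ≠ 0) : IsOpen (F '' U) := by
  rw [isOpen_iff_mem_nhds]
  rintro _ ⟨x, hx, rfl⟩
  have hs : HasStrictFDerivAt F
      (((fderiv ℝ F x).toContinuousLinearEquivOfDetNeZero (hdet x hx) : E ≃L[ℝ] E) : E →L[ℝ] E)
      x := by
    rw [ContinuousLinearMap.coe_toContinuousLinearEquivOfDetNeZero]
    exact (hF.contDiffAt (hU.mem_nhds hx)).hasStrictFDerivAt one_ne_zero
  rw [← hs.map_nhds_eq_of_equiv]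
  exact Filter.image_mem_map (hU.mem_nhds hx)

lemma exists_contDiffOn_leftInverse {F : E → E} {U : Set E} (hU : IsOpen U)
    (hF : ContDiffOn ℝ 1 F U) (hdet : ∀ x ∈ U, (fderiv ℝ F x).det ≠ 0) (hinj : Set.InjOn F U) :
    ∃ G : E → E, ContDiffOn ℝ 1 G (F '' U) ∧ ∀ x ∈ U, G (F x) = x := by
  have hG : ∀ x ∈ U, Function.invFunOn F U (F x) = x := fun x hx => hinj.leftInvOn_invFunOn hx
  refine ⟨Function.invFunOn F U, ?_, hG⟩
  rintro _ ⟨x, hx, rfl⟩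
  have hFx := hF.contDiffAt (hU.mem_nhds hx)
  have hs : HasStrictFDerivAt F
      (((fderiv ℝ F x).toContinuousLinearEquivOfDetNeZero (hdet x hx) : E ≃L[ℝ] E) : E →L[ℝ] E)
      x := by
    rw [ContinuousLinearMap.coe_toContinuousLinearEquivOfDetNeZero]
    exact hFx.hasStrictFDerivAt one_ne_zero
  refine ContDiffAt.contDiffWithinAt ?_
  refine (hFx.to_localInverse hs.hasFDerivAt one_ne_zero).congr_of_eventuallyEq ?_
  have hs' := hFx.hasStrictFDerivAt' hs.hasFDerivAt one_ne_zero
  have h1 := hs'.eventually_right_inverse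
  have h2 : ∀ᶠ y in nhds (F x), hs'.localInverse F _ x y ∈ U := by
    refine hs'.localInverse_continuousAt.eventually_mem ?_
    rw [hs'.localInverse_apply_image]
    exact hU.mem_nhds hx
  filter_upwards [h1, h2] with y hy1 hy2
  have := hG _ hy2
  rw [hy1] at this
  exact this

/-- An expanding local diffeomorphism covers a ball whose radius it does not shrink by more than
the expansion constant: the image of the larger ball is relatively clopen in the smaller one. -/
lemma ball_subset_image_ball {F : E → E} {U : Set E} (hF : ContDiffOn ℝ 1 F U)
    (hdet : ∀ x ∈ U, (fderiv ℝ F x).det ≠ 0)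
    (hexp : ∀ x ∈ U, ∀ y ∈ U, ‖x - y‖ ≤ 2 * ‖F x - F y‖) {p : E} {ε : ℝ} (hε : 0 < ε)
    (hp : closedBall p (2 * ε) ⊆ U) : ball (F p) ε ⊆ F '' ball p (2 * ε) := by
  have hbU : ball p (2 * ε) ⊆ U := ball_subset_closedBall.trans hp
  have hop : IsOpen (F '' ball p (2 * ε)) := isOpen_image_of_det_fderiv_ne_zero isOpen_ball
    (hF.mono hbU) fun x hx => hdet x (hbU hx)
  have hpU : p ∈ U := hp (mem_closedBall_self (by positivity))
  refine (isPreconnected_ball (E := E)).subset_of_closure_inter_subset hop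
    ⟨F p, mem_ball_self hε, p, mem_ball_self (by positivity), rfl⟩ ?_
  rintro y ⟨hy1, hy2⟩
  have hcl : closure (F '' ball p (2 * ε)) ⊆ F '' closedBall p (2 * ε) :=
    closure_minimal (Set.image_mono ball_subset_closedBall)
      ((isCompact_closedBall p (2 * ε)).image_of_continuousOn (hF.continuousOn.mono hp)).isClosed
  obtain ⟨x, hx, rfl⟩ := hcl hy1
  refine ⟨x, ?_, rfl⟩
  have h := hexp x (hp hx) p hpU
  rw [mem_ball, dist_eq_norm] at hy2 ⊢
  linarith

open scoped Manifold in
/-- A `C¹` function on a neighbourhood of a compact set `K` agrees on `K` with one defined on the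
whole space. -/
lemma exists_contDiff_eqOn_compact {φ : E → ℝ} {U K : Set E} (hU : IsOpen U) (hK : IsCompact K)
    (hKU : K ⊆ U) (hφ : ContDiffOn ℝ 1 φ U) : ∃ v : E → ℝ, ContDiff ℝ 1 v ∧ Set.EqOn v φ K := by
  obtain ⟨t, ht, hKt, htU⟩ := exists_compact_between hK hU hKU
  obtain ⟨χ, hχ1, hχ0, -⟩ := exists_contMDiffMap_one_nhds_of_subset_interior (n := 1) 𝓘(ℝ, E)
    hK.isClosed hKt
  have hχ : ContDiff ℝ 1 χ := χ.contMDiff.contDiff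
  refine ⟨fun x => χ x * φ x, contDiff_iff_contDiffAt.2 fun x => ?_, fun x hx => ?_⟩
  · by_cases hx : x ∈ U
    · exact hχ.contDiffAt.mul (hφ.contDiffAt (hU.mem_nhds hx))
    · refine (contDiffAt_const (c := (0 : ℝ))).congr_of_eventuallyEq ?_
      filter_upwards [ht.isClosed.isOpen_compl.mem_nhds fun h => hx (htU h)] with y hy
      simp [hχ0 y hy]
  · have : χ x = 1 := hχ1.self_of_nhdsSet x hx
    simp [this]

end ExpandingMap

section RotatedMap

variable {n : ℕ}

lemma clm_apply_eq_sum (l : EuclideanSpace ℝ (Fin n) →L[ℝ] ℝ) (h : EuclideanSpace ℝ (Fin n)) :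
    l h = ∑ j, h j * l (EuclideanSpace.single j 1) := by
  conv_lhs => rw [← (EuclideanSpace.basisFun (Fin n) ℝ).sum_repr h]
  simp [map_sum]

lemma toDual_symm_apply_coord (l : EuclideanSpace ℝ (Fin n) →L[ℝ] ℝ) (i : Fin n) :
    (InnerProductSpace.toDual ℝ (EuclideanSpace ℝ (Fin n))).symm l i =
      l (EuclideanSpace.single i 1) := by
  rw [← InnerProductSpace.toDual_symm_apply, EuclideanSpace.inner_single_right]
  simp

/-- The rotated coordinates `x̄ = cos θ x + sin θ Du(x)` on the gradient graph of `u`. -/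
noncomputable def rotatedMap (θ : ℝ) (u : EuclideanSpace ℝ (Fin n) → ℝ)
    (x : EuclideanSpace ℝ (Fin n)) : EuclideanSpace ℝ (Fin n) :=
  Real.cos θ • x + Real.sin θ • gradient u x

lemma contDiffOn_gradient {u : EuclideanSpace ℝ (Fin n) → ℝ} {U : Set (EuclideanSpace ℝ (Fin n))}
    (hU : IsOpen U) (hu : ContDiffOn ℝ ∞ u U) : ContDiffOn ℝ 1 (gradient u) U := by
  have h1 : ContDiffOn ℝ 1 (fderiv ℝ u) U := hu.fderiv_of_isOpen hU (by norm_cast)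
  exact (InnerProductSpace.toDual ℝ (EuclideanSpace ℝ (Fin n))).symm.contDiff.comp_contDiffOn h1

lemma contDiffOn_rotatedMap {u : EuclideanSpace ℝ (Fin n) → ℝ}
    {U : Set (EuclideanSpace ℝ (Fin n))} (hU : IsOpen U) (hu : ContDiffOn ℝ ∞ u U) (θ : ℝ) :
    ContDiffOn ℝ 1 (rotatedMap θ u) U :=
  (contDiffOn_id.const_smul _).add ((contDiffOn_gradient hU hu).const_smul _)

lemma hasFDerivAt_rotatedMap {u : EuclideanSpace ℝ (Fin n) → ℝ}
    {U : Set (EuclideanSpace ℝ (Fin n))} (hU : IsOpen U) (hu : ContDiffOn ℝ ∞ u U) (θ : ℝ)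
    {x : EuclideanSpace ℝ (Fin n)} (hx : x ∈ U) (hsymm : (GradientGraph.hessian u x).IsHermitian) :
    HasFDerivAt (rotatedMap θ u)
      (Matrix.toEuclideanCLM (𝕜 := ℝ) (rotatedJacobian θ (GradientGraph.hessian u x))) x := by
  have h1 : ContDiffOn ℝ 1 (fderiv ℝ u) U := hu.fderiv_of_isOpen hU (by norm_cast)
  have h2 := ((h1.contDiffAt (hU.mem_nhds hx)).differentiableAt one_ne_zero).hasFDerivAt
  have h3 : HasFDerivAt (gradient u)
      ((InnerProductSpace.toDual ℝ (EuclideanSpace ℝ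
        (Fin n))).symm.toContinuousLinearEquiv.toContinuousLinearMap.comp
          (fderiv ℝ (fderiv ℝ u) x)) x :=
    (InnerProductSpace.toDual ℝ
      (EuclideanSpace ℝ (Fin n))).symm.toContinuousLinearEquiv.hasFDerivAt.comp x h2
  have h4 := ((hasFDerivAt_id x).const_smul (Real.cos θ)).add (h3.const_smul (Real.sin θ))
  refine h4.congr_fderiv ?_
  ext h i
  have h5 : (InnerProductSpace.toDual ℝ (EuclideanSpace ℝ (Fin n))).symm
      (fderiv ℝ (fderiv ℝ u) x h) i = (GradientGraph.hessian u x *ᵥ h) i := by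
    rw [toDual_symm_apply_coord]
    have h6 : (fderiv ℝ (fderiv ℝ u) x h) (EuclideanSpace.single i 1) =
        ((fderiv ℝ (fderiv ℝ u) x).flip (EuclideanSpace.single i 1)) h := rfl
    rw [h6, clm_apply_eq_sum]
    refine Finset.sum_congr rfl fun j _ => ?_
    have h7 : GradientGraph.hessian u x i j = GradientGraph.hessian u x j i := by
      simpa using (hsymm.apply i j).symm
    calc _ = GradientGraph.hessian u x j i * h j := mul_comm _ _
      _ = GradientGraph.hessian u x i j * h j := by rw [h7]
  have h8 : (Matrix.toEuclideanCLM (𝕜 := ℝ) (rotatedJacobian θ (GradientGraph.hessian u x)) h) i =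
      (rotatedJacobian θ (GradientGraph.hessian u x) *ᵥ h) i := rfl
  rw [h8, rotatedJacobian, Matrix.add_mulVec, Matrix.smul_mulVec, Matrix.smul_mulVec,
    Matrix.one_mulVec]
  simp only [Pi.add_apply, Pi.smul_apply, ← h5]
  rfl

lemma det_toEuclideanCLM (A : Matrix (Fin n) (Fin n) ℝ) :
    (Matrix.toEuclideanCLM (𝕜 := ℝ) A).det = A.det := by
  rw [ContinuousLinearMap.det, Matrix.coe_toEuclideanCLM_eq_toEuclideanLin,
    Matrix.toEuclideanLin_eq_toLin_orthonormal, LinearMap.det_toLin]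

/-- Strong monotonicity of the rotated coordinate map, integrated from that of its derivative
along segments. -/
lemma norm_sub_le_two_mul_norm_rotatedMap_sub {δ : ℝ} (h0 : 0 < δ) (hπ : δ < Real.pi / 2)
    {u : EuclideanSpace ℝ (Fin n) → ℝ} {U : Set (EuclideanSpace ℝ (Fin n))} (hU : IsOpen U)
    (hUc : Convex ℝ U) (hu : ContDiffOn ℝ ∞ u U)
    (hH : ∀ x ∈ U, (GradientGraph.hessian u x - (-Real.cot δ) • 1).PosSemidef)
    {x y : EuclideanSpace ℝ (Fin n)} (hx : x ∈ U) (hy : y ∈ U) :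
    ‖x - y‖ ≤ 2 * ‖rotatedMap (δ / 2) u x - rotatedMap (δ / 2) u y‖ := by
  set F := rotatedMap (δ / 2) u with hF
  set A := fun z => Matrix.toEuclideanCLM (𝕜 := ℝ)
    (rotatedJacobian (δ / 2) (GradientGraph.hessian u z)) with hA
  have hseg : ∀ t ∈ Set.Icc (0 : ℝ) 1, y + t • (x - y) ∈ U := fun t ht =>
    hUc.add_smul_sub_mem hy hx ht
  have hder : ∀ t ∈ Set.Icc (0 : ℝ) 1, HasDerivAt
      (fun t : ℝ => inner ℝ (x - y) (F (y + t • (x - y))))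
      (inner ℝ (x - y) (A (y + t • (x - y)) (x - y))) t := fun t ht => by
    have h1 : HasDerivAt (fun t : ℝ => y + t • (x - y)) (x - y) t := by
      simpa using ((hasDerivAt_id t).smul_const (x - y)).const_add y
    have h2 := (hasFDerivAt_rotatedMap hU hu (δ / 2) (hseg t ht)
      (isHermitian_of_posSemidef_sub_smul_one (hH _ (hseg t ht)))).comp_hasDerivAt t h1
    exact (innerSL ℝ (x - y)).hasFDerivAt.comp_hasDerivAt t h2
  obtain ⟨t, ht, hslope⟩ := exists_hasDerivAt_eq_slope _ _ (zero_lt_one' ℝ)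
    (fun t ht => (hder t ht).continuousAt.continuousWithinAt)
    fun t ht => hder t (Set.Ioo_subset_Icc_self ht)
  have h3 := half_mul_le_dotProduct_rotatedJacobian h0 hπ
    (hH _ (hseg t (Set.Ioo_subset_Icc_self ht))) (x - y).ofLp
  have h4 : inner ℝ (x - y) (A (y + t • (x - y)) (x - y)) = (x - y).ofLp ⬝ᵥ
      (rotatedJacobian (δ / 2) (GradientGraph.hessian u (y + t • (x - y))) *ᵥ (x - y).ofLp) := by
    rw [EuclideanSpace.inner_eq_star_dotProduct, star_trivial, dotProduct_comm]
    rfl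
  have h5 : (x - y).ofLp ⬝ᵥ (x - y).ofLp = ‖x - y‖ ^ 2 := by
    rw [← real_inner_self_eq_norm_sq, EuclideanSpace.inner_eq_star_dotProduct, star_trivial]
  rw [← h4, h5, hslope] at h3
  simp only [one_smul, zero_smul, add_zero, add_sub_cancel, sub_zero, div_one,
    ← inner_sub_right] at h3
  have h6 := h3.trans (real_inner_le_norm _ _)
  rcases (norm_nonneg (x - y)).eq_or_lt with h7 | h7
  · rw [← h7]
    positivity
  · nlinarith

end RotatedMap

/-! ### A smoothed positive part -/

section SmoothedPosPart

/-- A `C¹` approximation of the positive part, at distance at most `a` below it, that vanishes on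
the negative half line and has slope in `[0, 1]`. -/
noncomputable def smoothedPosPart (a t : ℝ) : ℝ :=
  max t 0 ^ 2 / (max t 0 + a)

variable {a : ℝ}

lemma smoothedPosPart_of_nonpos {t : ℝ} (ht : t ≤ 0) : smoothedPosPart a t = 0 := by
  simp [smoothedPosPart, max_eq_right ht]

lemma smoothedPosPart_nonneg (ha : 0 < a) (t : ℝ) : 0 ≤ smoothedPosPart a t := by
  have := le_max_right t 0
  unfold smoothedPosPart
  positivity

lemma max_le_smoothedPosPart_add (ha : 0 < a) (t : ℝ) : max t 0 ≤ smoothedPosPart a t + a := by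
  have h := le_max_right t 0
  unfold smoothedPosPart
  rw [← sub_le_iff_le_add, le_div_iff₀ (by positivity)]
  nlinarith

lemma hasDerivAt_smoothedPosPart (ha : 0 < a) (t : ℝ) :
    HasDerivAt (smoothedPosPart a) (1 - a ^ 2 / (max t 0 + a) ^ 2) t := by
  have hpos : 0 ≤ t → HasDerivWithinAt (smoothedPosPart a) (1 - a ^ 2 / (max t 0 + a) ^ 2)
      (Set.Ici 0) t := fun ht => by
    have hta : t + a ≠ 0 := by positivity
    have h1 : HasDerivAt (fun t : ℝ => t ^ 2 / (t + a)) (1 - a ^ 2 / (max t 0 + a) ^ 2) t := by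
      refine (((hasDerivAt_id t).pow 2).div ((hasDerivAt_id t).add_const a) hta).congr_deriv ?_
      rw [max_eq_left ht]
      simp only [Pi.pow_apply, id]
      field_simp
      ring
    exact h1.hasDerivWithinAt.congr_of_mem (fun x hx => by
      rw [smoothedPosPart, max_eq_left hx]) ht
  have hneg : t ≤ 0 → HasDerivWithinAt (smoothedPosPart a) (1 - a ^ 2 / (max t 0 + a) ^ 2)
      (Set.Iic 0) t := fun ht => by
    have h0 : 1 - a ^ 2 / (max t 0 + a) ^ 2 = 0 := by
      rw [max_eq_right ht, zero_add, div_self (by positivity), sub_self]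
    rw [h0]
    exact (hasDerivWithinAt_const t (Set.Iic 0) (0 : ℝ)).congr_of_mem
      (fun x hx => smoothedPosPart_of_nonpos hx) ht
  rcases lt_trichotomy t 0 with ht | rfl | ht
  · exact (hneg ht.le).hasDerivAt (Iic_mem_nhds ht)
  · have := (hneg le_rfl).union (hpos le_rfl)
    rwa [Set.Iic_union_Ici, hasDerivWithinAt_univ] at this
  · exact (hpos ht.le).hasDerivAt (Ici_mem_nhds ht)

lemma contDiff_smoothedPosPart (ha : 0 < a) : ContDiff ℝ 1 (smoothedPosPart a) := by
  rw [contDiff_one_iff_deriv]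
  refine ⟨fun t => (hasDerivAt_smoothedPosPart ha t).differentiableAt, ?_⟩
  rw [funext fun t => (hasDerivAt_smoothedPosPart ha t).deriv]
  refine continuous_const.sub (continuous_const.div (by fun_prop) fun t => ?_)
  have := le_max_right t 0
  positivity

end SmoothedPosPart

/-! ### Integrals in rotated coordinates -/

section ChangeOfVariables

open GradientGraph

variable {n : ℕ} {δ : ℝ} {u : EuclideanSpace ℝ (Fin n) → ℝ} {U B : Set (EuclideanSpace ℝ (Fin n))}

lemma det_rotatedJacobian_pos (h0 : 0 < δ) (hπ : δ < Real.pi / 2)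
    {H : Matrix (Fin n) (Fin n) ℝ} (hH : (H - (-Real.cot δ) • 1).PosSemidef) :
    0 < (rotatedJacobian (δ / 2) H).det :=
  lt_of_lt_of_le (by positivity) (rotatedJacobian_metric_comparison h0 hπ hH).1

lemma det_fderiv_rotatedMap_ne_zero (h0 : 0 < δ) (hπ : δ < Real.pi / 2) (hU : IsOpen U)
    (hu : ContDiffOn ℝ ∞ u U) (hH : ∀ x ∈ U, (hessian u x - (-Real.cot δ) • 1).PosSemidef) :
    ∀ x ∈ U, (fderiv ℝ (rotatedMap (δ / 2) u) x).det ≠ 0 := fun x hx => by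
  rw [(hasFDerivAt_rotatedMap hU hu _ hx
    (isHermitian_of_posSemidef_sub_smul_one (hH x hx))).fderiv, det_toEuclideanCLM]
  exact (det_rotatedJacobian_pos h0 hπ (hH x hx)).ne'

lemma injOn_rotatedMap (h0 : 0 < δ) (hπ : δ < Real.pi / 2) (hU : IsOpen U) (hUc : Convex ℝ U)
    (hu : ContDiffOn ℝ ∞ u U) (hH : ∀ x ∈ U, (hessian u x - (-Real.cot δ) • 1).PosSemidef) :
    Set.InjOn (rotatedMap (δ / 2) u) U := fun x hx y hy hxy => by
  have := norm_sub_le_two_mul_norm_rotatedMap_sub h0 hπ hU hUc hu hH hx hy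
  rw [hxy, sub_self, norm_zero, mul_zero] at this
  exact sub_eq_zero.1 (norm_le_zero_iff.1 this)

lemma lintegral_image_rotatedMap (h0 : 0 < δ) (hπ : δ < Real.pi / 2) (hU : IsOpen U)
    (hUc : Convex ℝ U) (hu : ContDiffOn ℝ ∞ u U)
    (hH : ∀ x ∈ U, (hessian u x - (-Real.cot δ) • 1).PosSemidef) (hB : MeasurableSet B)
    (hBU : B ⊆ U) (g : EuclideanSpace ℝ (Fin n) → ℝ≥0∞) :
    ∫⁻ y in rotatedMap (δ / 2) u '' B, g y =
      ∫⁻ x in B, ENNReal.ofReal (rotatedJacobian (δ / 2) (hessian u x)).det *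
        g (rotatedMap (δ / 2) u x) := by
  rw [lintegral_image_eq_lintegral_abs_det_fderiv_mul volume hB
    (fun x hx => (hasFDerivAt_rotatedMap hU hu _ (hBU hx)
      (isHermitian_of_posSemidef_sub_smul_one (hH x (hBU hx)))).hasFDerivWithinAt)
    ((injOn_rotatedMap h0 hπ hU hUc hu hH).mono hBU)]
  refine setLIntegral_congr_fun hB fun x hx => ?_
  simp only [det_toEuclideanCLM, abs_of_pos (det_rotatedJacobian_pos h0 hπ (hH x (hBU hx)))]

lemma volume_le_volume_image_rotatedMap (h0 : 0 < δ) (hπ : δ < Real.pi / 2) (hU : IsOpen U)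
    (hUc : Convex ℝ U) (hu : ContDiffOn ℝ ∞ u U)
    (hH : ∀ x ∈ U, (hessian u x - (-Real.cot δ) • 1).PosSemidef) (hB : MeasurableSet B)
    (hBU : B ⊆ U) : volume B ≤ 2 ^ n * volume (rotatedMap (δ / 2) u '' B) := by
  have h1 := lintegral_image_rotatedMap h0 hπ hU hUc hu hH hB hBU fun _ => 1
  simp only [setLIntegral_const, one_mul, mul_one] at h1
  rw [h1, ← lintegral_const_mul' _ _ (by finiteness), ← setLIntegral_one]
  refine setLIntegral_mono' hB fun x hx => ?_
  have h2 := (rotatedJacobian_metric_comparison h0 hπ (hH x (hBU hx))).1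
  rw [Fintype.card_fin] at h2
  calc (1 : ℝ≥0∞) = ENNReal.ofReal (2 ^ n * (1 / 2) ^ n) := by
        rw [← mul_pow]
        norm_num
    _ ≤ ENNReal.ofReal (2 ^ n * (rotatedJacobian (δ / 2) (hessian u x)).det) := by gcongr
    _ = _ := by
        rw [ENNReal.ofReal_mul (by positivity), ENNReal.ofReal_pow zero_le_two,
          ENNReal.ofReal_ofNat]

lemma measurable_hessian_apply (u : EuclideanSpace ℝ (Fin n) → ℝ) (i j : Fin n) :
    Measurable fun x => hessian u x i j := by
  have h1 : Measurable (fderiv ℝ (fderiv ℝ u)) := measurable_fderiv ℝ _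
  have h2 := (ContinuousLinearMap.apply ℝ (EuclideanSpace ℝ (Fin n) →L[ℝ] ℝ)
    (EuclideanSpace.single i (1 : ℝ))).continuous.measurable.comp h1
  exact (ContinuousLinearMap.apply ℝ ℝ
    (EuclideanSpace.single j (1 : ℝ))).continuous.measurable.comp h2

lemma measurable_sqrt_det_metric (u : EuclideanSpace ℝ (Fin n) → ℝ) :
    Measurable fun x => ENNReal.ofReal √(metric u x).det := by
  refine ENNReal.measurable_ofReal.comp (Real.continuous_sqrt.measurable.comp ?_)
  simp only [Matrix.det_apply]
  refine Finset.measurable_sum _ fun σ _ => Measurable.const_smul ?_ _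
  refine Finset.measurable_prod _ fun i _ => ?_
  simp only [metric, sq, Matrix.add_apply, Matrix.mul_apply]
  exact measurable_const.add (Finset.measurable_sum _ fun k _ =>
    (measurable_hessian_apply u _ _).mul (measurable_hessian_apply u _ _))

lemma setLIntegral_volG (hB : MeasurableSet B) (h : EuclideanSpace ℝ (Fin n) → ℝ≥0∞) :
    ∫⁻ x in B, h x ∂(volG u) = ∫⁻ x in B, ENNReal.ofReal √(metric u x).det * h x := by
  rw [volG, restrict_withDensity hB,
    lintegral_withDensity_eq_lintegral_mul_non_measurable _ (measurable_sqrt_det_metric u)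
      (.of_forall fun _ => ENNReal.ofReal_lt_top)]
  rfl

lemma setLIntegral_volG_le (h0 : 0 < δ) (hπ : δ < Real.pi / 2) (hU : IsOpen U)
    (hUc : Convex ℝ U) (hu : ContDiffOn ℝ ∞ u U)
    (hH : ∀ x ∈ U, (hessian u x - (-Real.cot δ) • 1).PosSemidef) (hB : MeasurableSet B)
    (hBU : B ⊆ U) (g : EuclideanSpace ℝ (Fin n) → ℝ≥0∞) :
    ∫⁻ x in B, g (rotatedMap (δ / 2) u x) ∂(volG u) ≤
      ENNReal.ofReal (1 / Real.sin (δ / 2)) ^ n *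
        ∫⁻ y in rotatedMap (δ / 2) u '' B, g y := by
  have hs : 0 < Real.sin (δ / 2) := Real.sin_pos_of_pos_of_lt_pi (by linarith) (by linarith)
  rw [setLIntegral_volG hB, lintegral_image_rotatedMap h0 hπ hU hUc hu hH hB hBU,
    ← lintegral_const_mul' _ _ (by finiteness)]
  refine setLIntegral_mono' hB fun x hx => ?_
  rw [← mul_assoc, ← ENNReal.ofReal_pow (by positivity), ← ENNReal.ofReal_mul (by positivity)]
  gcongr
  have := (rotatedJacobian_metric_comparison h0 hπ (hH x (hBU hx))).2.1
  rwa [Fintype.card_fin] at this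

lemma norm_eq_sqrt_dotProduct_partials (l : EuclideanSpace ℝ (Fin n) →L[ℝ] ℝ) :
    ‖l‖ = √((fun i => l (EuclideanSpace.single i 1)) ⬝ᵥ
      fun i => l (EuclideanSpace.single i 1)) := by
  rw [← (InnerProductSpace.toDual ℝ (EuclideanSpace ℝ (Fin n))).symm.norm_map l,
    EuclideanSpace.norm_eq]
  congr 1
  refine Finset.sum_congr rfl fun i _ => ?_
  rw [toDual_symm_apply_coord, Real.norm_eq_abs, sq_abs, sq]

/-- The area-weighted length of the gradient of a function on the graph is at least its Euclidean
counterpart in the rotated coordinates. -/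
lemma det_mul_norm_fderiv_le_gradNormG (h0 : 0 < δ) (hπ : δ < Real.pi / 2) (hU : IsOpen U)
    (hu : ContDiffOn ℝ ∞ u U) {x : EuclideanSpace ℝ (Fin n)} (hx : x ∈ U)
    (hH : (hessian u x - (-Real.cot δ) • 1).PosSemidef) {v φ : EuclideanSpace ℝ (Fin n) → ℝ}
    (hv : DifferentiableAt ℝ v (rotatedMap (δ / 2) u x))
    (hφ : φ =ᶠ[nhds x] v ∘ rotatedMap (δ / 2) u) :
    (rotatedJacobian (δ / 2) (hessian u x)).det * ‖fderiv ℝ v (rotatedMap (δ / 2) u x)‖ ≤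
      √(metric u x).det * gradNormG u φ x := by
  set A := rotatedJacobian (δ / 2) (hessian u x) with hA
  have hsymm := isHermitian_of_posSemidef_sub_smul_one hH
  set l := fderiv ℝ v (rotatedMap (δ / 2) u x) with hl
  set y : Fin n → ℝ := fun i => l (EuclideanSpace.single i 1) with hy
  have hAT : Aᵀ = A := by
    have : (hessian u x)ᵀ = hessian u x := hsymm
    rw [hA, rotatedJacobian, Matrix.transpose_add, Matrix.transpose_smul, Matrix.transpose_smul,
      Matrix.transpose_one, this]
  have hp : partials φ x = A *ᵥ y := by
    have h1 := (hv.hasFDerivAt.comp x (hasFDerivAt_rotatedMap hU hu (δ / 2) hx hsymm))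
    funext i
    rw [partials, hφ.fderiv_eq, h1.fderiv, ContinuousLinearMap.comp_apply, clm_apply_eq_sum,
      ← hAT]
    refine Finset.sum_congr rfl fun j _ => ?_
    have : (Matrix.toEuclideanCLM (𝕜 := ℝ) A (EuclideanSpace.single i 1)) j = A j i := by
      change (A *ᵥ Pi.single i 1) j = A j i
      simp
    rw [← hA, this]
    rfl
  rw [norm_eq_sqrt_dotProduct_partials, gradNormG, hp, mul_comm, mul_comm √(metric u x).det]
  exact (rotatedJacobian_metric_comparison h0 hπ hH).2.2 y

lemma lintegral_image_fderiv_le_volG (h0 : 0 < δ) (hπ : δ < Real.pi / 2) (hU : IsOpen U)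
    (hUc : Convex ℝ U) (hu : ContDiffOn ℝ ∞ u U)
    (hH : ∀ x ∈ U, (hessian u x - (-Real.cot δ) • 1).PosSemidef) (hB : IsOpen B)
    (hBU : B ⊆ U) {v φ : EuclideanSpace ℝ (Fin n) → ℝ} (hv : ContDiff ℝ 1 v)
    (hφ : Set.EqOn φ (v ∘ rotatedMap (δ / 2) u) B) :
    ∫⁻ y in rotatedMap (δ / 2) u '' B, ‖fderiv ℝ v y‖ₑ ≤
      ∫⁻ x in B, ENNReal.ofReal (gradNormG u φ x) ∂(volG u) := by
  rw [setLIntegral_volG hB.measurableSet,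
    lintegral_image_rotatedMap h0 hπ hU hUc hu hH hB.measurableSet hBU]
  refine setLIntegral_mono' hB.measurableSet fun x hx => ?_
  rw [← ofReal_norm, ← ENNReal.ofReal_mul (det_rotatedJacobian_pos h0 hπ (hH x (hBU hx))).le,
    ← ENNReal.ofReal_mul (Real.sqrt_nonneg _)]
  exact ENNReal.ofReal_le_ofReal (det_mul_norm_fderiv_le_gradNormG h0 hπ hU hu (hBU hx)
    (hH x (hBU hx)) (hv.differentiable one_ne_zero _)
    (Filter.eventuallyEq_of_mem (hB.mem_nhds hx) hφ))

end ChangeOfVariables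

/-! ### Level of the positive part, and its gradient -/

section Excess

open GradientGraph

variable {n : ℕ}

lemma enorm_le_eLpNorm_top_of_continuousOn {E F : Type*} [TopologicalSpace E] [MeasurableSpace E]
    [OpensMeasurableSpace E] [NormedAddCommGroup F] {μ : Measure E} [μ.IsOpenPosMeasure]
    {h : E → F} {U : Set E} (hU : IsOpen U) (hh : ContinuousOn h U) {x : E} (hx : x ∈ U) :
    ‖h x‖ₑ ≤ eLpNorm h ⊤ (μ.restrict U) := by
  refine le_of_forall_lt fun b hb => ?_
  have hW : {y | b < ‖h y‖ₑ} ∩ U ∈ nhds x :=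
    Filter.inter_mem ((hh.continuousAt (hU.mem_nhds hx)).enorm.eventually_const_lt hb)
      (hU.mem_nhds hx)
  have hpos := Measure.measure_pos_of_mem_nhds μ hW
  rw [← Measure.restrict_apply' hU.measurableSet] at hpos
  have hae : ∀ᵐ y ∂(μ.restrict U), ‖h y‖ₑ ≤ eLpNorm h ⊤ (μ.restrict U) := by
    rw [eLpNorm_exponent_top]
    exact ae_le_eLpNormEssSup
  obtain ⟨y, hy1, hy2⟩ := ((frequently_ae_mem_iff.2 hpos.ne').and_eventually hae).exists
  exact lt_of_lt_of_le hy1 hy2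

/-- Markov's inequality for the level `f̃`: on at least half of `B_r` the function is below it. -/
lemma volume_ball_le_two_mul_volume_le_ftilde {f : EuclideanSpace ℝ (Fin n) → ℝ} {r R : ℝ}
    (hr : 0 < r) (hrR : r < R) (hf : ContinuousOn f (closedBall 0 R))
    (hpos : ∀ x ∈ closedBall (0 : EuclideanSpace ℝ (Fin n)) R, 0 < f x) :
    MeasurableSet (ball 0 r ∩ {x | f x ≤ ftilde f r R}) ∧
    volume (ball (0 : EuclideanSpace ℝ (Fin n)) r) ≤
      2 * volume (ball 0 r ∩ {x | f x ≤ ftilde f r R}) := by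
  set t := ftilde f r R with ht
  set P := ball 0 r ∩ f ⁻¹' Set.Ioi t with hP
  have hrc : ball (0 : EuclideanSpace ℝ (Fin n)) r ⊆ closedBall 0 R :=
    ball_subset_closedBall.trans (closedBall_subset_closedBall hrR.le)
  have hPo : IsOpen P := (hf.mono hrc).isOpen_inter_preimage isOpen_ball isOpen_Ioi
  have hW : ball 0 r ∩ {x | f x ≤ t} = ball 0 r \ P := by
    ext x
    simp only [hP, Set.mem_inter_iff, Set.mem_sdiff, Set.mem_preimage, Set.mem_Ioi]
    constructor
    · rintro ⟨h1, h2⟩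
      exact ⟨h1, fun h => (not_lt.2 h2) h.2⟩
    · rintro ⟨h1, h2⟩
      exact ⟨h1, not_lt.1 fun h => h2 ⟨h1, h⟩⟩
  have hint : IntegrableOn f (ball 0 R) :=
    (hf.integrableOn_compact (isCompact_closedBall 0 R)).mono_set ball_subset_closedBall
  have hV : 0 < volume.real (ball (0 : EuclideanSpace ℝ (Fin n)) r) :=
    ENNReal.toReal_pos (measure_ball_pos _ _ hr).ne' measure_ball_lt_top.ne
  have hI : 0 < ∫ x in ball (0 : EuclideanSpace ℝ (Fin n)) R, f x := by
    rw [setIntegral_pos_iff_support_of_nonneg_ae _ hint]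
    · have : Function.support f ∩ ball 0 R = ball 0 R :=
        Set.inter_eq_right.2 fun x hx => (hpos x (ball_subset_closedBall hx)).ne'
      rw [this]
      exact measure_ball_pos _ _ (hr.trans hrR)
    · exact (ae_restrict_iff' measurableSet_ball).2
        (.of_forall fun x hx => (hpos x (ball_subset_closedBall hx)).le)
  have htI : t * volume.real (ball (0 : EuclideanSpace ℝ (Fin n)) r) =
      2 * ∫ x in ball (0 : EuclideanSpace ℝ (Fin n)) R, f x := by
    rw [ht, ftilde]
    field_simp
  have ht0 : 0 < t := by
    rw [ht, ftilde]
    positivity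
  have hPR : P ⊆ ball 0 R := Set.inter_subset_left.trans (ball_subset_ball hrR.le)
  have hPt : volume P ≠ ⊤ := measure_ne_top_of_subset hPR measure_ball_lt_top.ne
  have hmarkov : t * volume.real P ≤ ∫ x in ball (0 : EuclideanSpace ℝ (Fin n)) R, f x := by
    calc t * volume.real P = ∫ _x in P, t := by
          rw [setIntegral_const, smul_eq_mul, mul_comm]
      _ ≤ ∫ x in P, f x := setIntegral_mono_on (integrableOn_const hPt (by simp))
          (hint.mono_set hPR) hPo.measurableSet fun x hx => (le_of_lt hx.2)
      _ ≤ _ := setIntegral_mono_set hint ((ae_restrict_iff' measurableSet_ball).2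
        (.of_forall fun x hx => (hpos x (ball_subset_closedBall hx)).le)) hPR.eventuallyLE
  have hhalf : 2 * volume.real P ≤ volume.real (ball (0 : EuclideanSpace ℝ (Fin n)) r) := by
    refine le_of_mul_le_mul_left ?_ ht0
    linarith
  rw [hW]
  refine ⟨measurableSet_ball.diff hPo.measurableSet, ?_⟩
  have hhalf' : 2 * volume P ≤ volume (ball (0 : EuclideanSpace ℝ (Fin n)) r) := by
    rw [← ENNReal.toReal_le_toReal (by finiteness) measure_ball_lt_top.ne, ENNReal.toReal_mul]
    exact hhalf
  rw [measure_sdiff Set.inter_subset_left hPo.measurableSet.nullMeasurableSet hPt,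
    ENNReal.mul_sub (by simp)]
  refine ENNReal.le_sub_of_add_le_right (by finiteness) ?_
  rw [two_mul (volume (ball (0 : EuclideanSpace ℝ (Fin n)) r))]
  gcongr

lemma gradNormG_smoothedPosPart_le (u : EuclideanSpace ℝ (Fin n) → ℝ)
    {f : EuclideanSpace ℝ (Fin n) → ℝ} {x : EuclideanSpace ℝ (Fin n)} (hf : ContDiffAt ℝ 1 f x)
    (r R : ℝ) {a : ℝ} (ha : 0 < a) :
    gradNormG u (fun x => smoothedPosPart a (f x - ftilde f r R)) x ≤
      gradNormG u (excess f r R) x := by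
  set t := ftilde f r R with ht
  set k := 1 - a ^ 2 / (max (f x - t) 0 + a) ^ 2 with hk
  have hfd := hf.differentiableAt one_ne_zero
  have h1 : HasFDerivAt (fun x => smoothedPosPart a (f x - t)) (k • fderiv ℝ f x) x :=
    HasDerivAt.comp_hasFDerivAt (h₂ := smoothedPosPart a) x
      (hasDerivAt_smoothedPosPart ha (f x - t)) (hfd.hasFDerivAt.sub_const t)
  have hp : partials (fun x => smoothedPosPart a (f x - t)) x = k • partials f x := by
    funext i
    simp only [partials, h1.fderiv]
    rfl
  have hm := le_max_right (f x - t) 0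
  have hk1 : k ≤ 1 := by
    rw [hk]
    have : 0 ≤ a ^ 2 / (max (f x - t) 0 + a) ^ 2 := by positivity
    linarith
  have hk0 : 0 ≤ k := by
    rw [hk, sub_nonneg, div_le_one (by positivity)]
    exact pow_le_pow_left₀ ha.le (by linarith) 2
  have hsq : gradNormG u (fun x => smoothedPosPart a (f x - t)) x = k * gradNormG u f x := by
    rw [gradNormG, gradNormG, hp, Matrix.mulVec_smul, dotProduct_smul, smul_dotProduct, smul_smul,
      smul_eq_mul, Real.sqrt_mul (by positivity), Real.sqrt_mul_self hk0]
  rw [hsq]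
  rcases le_or_gt (f x) t with hx | hx
  · have : k = 0 := by
      rw [hk, max_eq_right (by linarith), zero_add, div_self (by positivity), sub_self]
    rw [this, zero_mul]
    exact Real.sqrt_nonneg _
  · have hpe : partials (excess f r R) x = partials f x := by
      have h2 : excess f r R =ᶠ[nhds x] fun y => f y - t := by
        filter_upwards [hf.continuousAt.eventually_const_lt hx] with y hy
        rw [excess, ← ht, max_eq_left (by linarith)]
      funext i
      rw [partials, h2.fderiv_eq, fderiv_sub_const, partials]
    calc k * gradNormG u f x ≤ 1 * gradNormG u f x :=
          mul_le_mul_of_nonneg_right hk1 (Real.sqrt_nonneg _)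
      _ = gradNormG u (excess f r R) x := by rw [one_mul, gradNormG, gradNormG, hpe]

/-! ### The Sobolev inequality on the graph -/

/-- The smoothed excess of `f` over `f̃`, as a `C¹` function `V` of the rotated coordinates. The
inverse of `rotatedMap` exists only on the image of `B_{R'}`, so `V` is prescribed on the image of
`B_R` and extended to the whole space. -/
lemma exists_contDiff_rotated_excess {δ : ℝ} (h0 : 0 < δ) (hπ : δ < Real.pi / 2)
    {u f : EuclideanSpace ℝ (Fin n) → ℝ} {r R R' : ℝ} (hRR' : R < R')
    (hu : ContDiffOn ℝ ∞ u (ball 0 R'))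
    (hH : ∀ x ∈ ball (0 : EuclideanSpace ℝ (Fin n)) R',
      (hessian u x - (-Real.cot δ) • 1).PosSemidef)
    (hf : ContDiffOn ℝ ∞ f (ball 0 R')) {a : ℝ} (ha : 0 < a) :
    ∃ V : EuclideanSpace ℝ (Fin n) → ℝ, ContDiff ℝ 1 V ∧
      (∀ x ∈ ball (0 : EuclideanSpace ℝ (Fin n)) R,
        smoothedPosPart a (f x - ftilde f r R) = V (rotatedMap (δ / 2) u x)) ∧
      ∫⁻ y in rotatedMap (δ / 2) u '' ball 0 R, ‖fderiv ℝ V y‖ₑ ≤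
        ∫⁻ x in ball 0 R, ENNReal.ofReal (gradNormG u (excess f r R) x) ∂(volG u) := by
  have hU : IsOpen (ball (0 : EuclideanSpace ℝ (Fin n)) R') := isOpen_ball
  have hUc : Convex ℝ (ball (0 : EuclideanSpace ℝ (Fin n)) R') := convex_ball _ _
  have hBU : ball (0 : EuclideanSpace ℝ (Fin n)) R ⊆ ball 0 R' := ball_subset_ball hRR'.le
  have hcU : closedBall (0 : EuclideanSpace ℝ (Fin n)) R ⊆ ball 0 R' :=
    closedBall_subset_ball hRR'
  have hF := contDiffOn_rotatedMap hU hu (δ / 2)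
  have hdet := det_fderiv_rotatedMap_ne_zero h0 hπ hU hu hH
  have hf1 : ContDiffOn ℝ 1 f (ball 0 R') := hf.of_le (by norm_cast)
  obtain ⟨G, hG, hGF⟩ := exists_contDiffOn_leftInverse hU hF hdet
    (injOn_rotatedMap h0 hπ hU hUc hu hH)
  have hφ : ContDiffOn ℝ 1 (fun y => smoothedPosPart a (f (G y) - ftilde f r R))
      (rotatedMap (δ / 2) u '' ball 0 R') := by
    refine (contDiff_smoothedPosPart ha).comp_contDiffOn (ContDiffOn.sub ?_ contDiffOn_const)
    refine hf1.comp hG ?_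
    rintro _ ⟨x, hx, rfl⟩
    rwa [hGF x hx]
  obtain ⟨V, hV, hVeq⟩ := exists_contDiff_eqOn_compact
    (isOpen_image_of_det_fderiv_ne_zero hU hF hdet)
    ((isCompact_closedBall (0 : EuclideanSpace ℝ (Fin n)) R).image_of_continuousOn
      (hF.continuousOn.mono hcU)) (Set.image_mono hcU) hφ
  have hVF : ∀ x ∈ ball (0 : EuclideanSpace ℝ (Fin n)) R,
      smoothedPosPart a (f x - ftilde f r R) = V (rotatedMap (δ / 2) u x) := fun x hx => by
    rw [hVeq ⟨x, ball_subset_closedBall hx, rfl⟩]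
    simp only [hGF x (hBU hx)]
  refine ⟨V, hV, hVF, ?_⟩
  refine (lintegral_image_fderiv_le_volG h0 hπ hU hUc hu hH isOpen_ball hBU hV
    (φ := fun x => smoothedPosPart a (f x - ftilde f r R)) hVF).trans ?_
  rw [setLIntegral_volG measurableSet_ball, setLIntegral_volG measurableSet_ball]
  refine setLIntegral_mono' measurableSet_ball fun x hx => ?_
  gcongr
  exact gradNormG_smoothedPosPart_le u (hf1.contDiffAt (hU.mem_nhds (hBU hx))) r R ha

end Excess

open GradientGraph in
theorem proposition4p1 (n : ℕ) (hn : 2 ≤ n) :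
    ∃ C : ℝ, 0 < C ∧
      ∀ (u f : EuclideanSpace ℝ (Fin n) → ℝ) (δ r R R' ε : ℝ),
        0 < δ → δ < Real.pi / 2 →
        0 < r → r < R → R < R' → 0 < ε → 2 * ε < R - r →
        ContDiffOn ℝ ∞ u (ball 0 R') →
        (∀ x ∈ ball (0 : EuclideanSpace ℝ (Fin n)) R',
          (GradientGraph.hessian u x - (-Real.cot δ) • 1).PosSemidef) →
        ContDiffOn ℝ ∞ f (ball 0 R') →
        (∀ x ∈ ball (0 : EuclideanSpace ℝ (Fin n)) R', 0 < f x) →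
        (∫⁻ x in ball 0 r,
            ENNReal.ofReal (GradientGraph.excess f r R x ^ ((n : ℝ) / ((n : ℝ) - 1)))
              ∂(GradientGraph.volG u)) ^ (((n : ℝ) - 1) / (n : ℝ)) ≤
          ENNReal.ofReal C *
            (ENNReal.ofReal ((1 / Real.sin (δ / 2)) ^ 2) * GradientGraph.rho u R' ^ 2 /
              ENNReal.ofReal (r * ε)) ^ (n - 1) *
            ∫⁻ x in ball 0 R,
              ENNReal.ofReal (GradientGraph.gradNormG u (GradientGraph.excess f r R) x)
                ∂(GradientGraph.volG u) := by
  have hn1 : (1 : ℝ) < n := by exact_mod_cast hn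
  have hconj := (Real.HolderConjugate.conjExponent hn1).toNNReal
  set q : NNReal := (Real.conjExponent n).toNNReal with hq
  rw [Real.toNNReal_natCast] at hconj
  have hqr : (q : ℝ) = n / (n - 1) := by
    rw [hq, Real.coe_toNNReal _ (Real.HolderConjugate.conjExponent hn1).symm.nonneg]
    rfl
  have hqr0 : 0 < (q : ℝ) := by
    rw [hqr]
    have : 0 < (n : ℝ) - 1 := by linarith
    positivity
  have hq1 : (1 : ℝ≥0∞) ≤ q := by exact_mod_cast hconj.symm.lt.le
  have hqinv : ((n : ℝ) - 1) / n = (q : ℝ)⁻¹ := by rw [hqr, inv_div]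
  obtain ⟨K, hK, hmain⟩ := exists_eLpNorm_le_of_volume_zeroSet hn hconj
  refine ⟨(K * 3 ^ (n - 1)).toReal + 1, by positivity, ?_⟩
  intro u f δ r R R' ε h0 hπ hr hrR hRR' hε hεR hu hH hf hfpos
  have hU : IsOpen (ball (0 : EuclideanSpace ℝ (Fin n)) R') := isOpen_ball
  have hUc : Convex ℝ (ball (0 : EuclideanSpace ℝ (Fin n)) R') := convex_ball _ _
  have hBU : ball (0 : EuclideanSpace ℝ (Fin n)) R ⊆ ball 0 R' := ball_subset_ball hRR'.le
  have hcU : closedBall (0 : EuclideanSpace ℝ (Fin n)) R ⊆ ball 0 R' :=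
    closedBall_subset_ball hRR'
  have hrB : ball (0 : EuclideanSpace ℝ (Fin n)) r ⊆ ball 0 R := ball_subset_ball hrR.le
  have hR : 0 < R := hr.trans hrR
  have hs : 0 < Real.sin (δ / 2) := Real.sin_pos_of_pos_of_lt_pi (by linarith) (by linarith)
  set F := rotatedMap (δ / 2) u with hFdef
  have hF := contDiffOn_rotatedMap hU hu (δ / 2)
  have hdet := det_fderiv_rotatedMap_ne_zero h0 hπ hU hu hH
  have hexp : ∀ x ∈ ball (0 : EuclideanSpace ℝ (Fin n)) R', ∀ y ∈ ball 0 R',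
      ‖x - y‖ ≤ 2 * ‖F x - F y‖ := fun x hx y hy =>
    norm_sub_le_two_mul_norm_rotatedMap_sub h0 hπ hU hUc hu hH hx hy
  have hgrad := (contDiffOn_gradient hU hu).continuousOn
  -- the maximum of `|Du|` over the closed ball is finite even where `rho u R'` is not
  obtain ⟨xm, hxm, hmax⟩ := (isCompact_closedBall (0 : EuclideanSpace ℝ (Fin n)) R).exists_isMaxOn
    ⟨0, mem_closedBall_self hR.le⟩ (hgrad.mono hcU).norm
  set M := ‖gradient u xm‖ with hM
  set ρ := R + M with hρ
  have hM0 : 0 ≤ M := norm_nonneg _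
  have hρrho : ENNReal.ofReal ρ ≤ rho u R' := by
    rw [hρ, ENNReal.ofReal_add hR.le hM0, rho]
    refine add_le_add (ENNReal.ofReal_le_ofReal hRR'.le) ?_
    rw [hM, ofReal_norm]
    exact enorm_le_eLpNorm_top_of_continuousOn hU hgrad (hcU hxm)
  set S := F '' ball 0 r with hS
  set T := F '' ball 0 R with hT
  have hopen : ∀ B : Set (EuclideanSpace ℝ (Fin n)), IsOpen B → B ⊆ ball 0 R' → IsOpen (F '' B) :=
    fun B hB hBU => isOpen_image_of_det_fderiv_ne_zero hB (hF.mono hBU)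
      fun x hx => hdet x (hBU hx)
  have hSm : MeasurableSet S := (hopen _ isOpen_ball (hrB.trans hBU)).measurableSet
  have hTm : MeasurableSet T := (hopen _ isOpen_ball hBU).measurableSet
  have hSc : IsPreconnected S :=
    (isPreconnected_ball).image F (hF.continuousOn.mono (hrB.trans hBU))
  have hSρ : S ⊆ closedBall 0 ρ := by
    rintro _ ⟨x, hx, rfl⟩
    rw [mem_closedBall_zero_iff, hFdef, rotatedMap]
    have hx' := hrB hx
    refine (norm_add_le _ _).trans (add_le_add ?_ ?_)
    · rw [norm_smul]
      have h1 : ‖Real.cos (δ / 2)‖ ≤ 1 := Real.abs_cos_le_one _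
      have h2 : ‖x‖ ≤ R := (mem_ball_zero_iff.1 hx').le
      nlinarith [norm_nonneg x]
    · rw [norm_smul]
      have h1 : ‖Real.sin (δ / 2)‖ ≤ 1 := Real.abs_sin_le_one _
      have h2 : ‖gradient u x‖ ≤ M := hmax (ball_subset_closedBall hx')
      nlinarith [norm_nonneg (gradient u x)]
  have hST : ∀ p ∈ S, ball p (3 * (ε / 3)) ⊆ T := by
    rintro _ ⟨x, hx, rfl⟩
    rw [mul_div_cancel₀ _ (three_ne_zero' ℝ)]
    have h1 : closedBall x (2 * ε) ⊆ ball 0 R := by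
      refine closedBall_subset_ball' ?_
      have := mem_ball.1 hx
      linarith
    exact (ball_subset_image_ball hF hdet hexp hε (h1.trans hBU)).trans
      (Set.image_mono (ball_subset_closedBall.trans h1))
  obtain ⟨hWm, hW⟩ := volume_ball_le_two_mul_volume_le_ftilde hr hrR (hf.continuousOn.mono hcU)
    fun x hx => hfpos x (hcU hx)
  set W := ball (0 : EuclideanSpace ℝ (Fin n)) r ∩ {x | f x ≤ ftilde f r R} with hWdef
  have hWU : W ⊆ ball 0 R' := Set.inter_subset_left.trans (hrB.trans hBU)
  set D := ∫⁻ x in ball 0 R, ENNReal.ofReal (gradNormG u (excess f r R) x) ∂(volG u) with hD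
  set σ := ENNReal.ofReal (1 / Real.sin (δ / 2)) with hσ
  set X := σ ^ (n - 1) * (K * ENNReal.ofReal (ρ ^ 2 / (r * (ε / 3))) ^ (n - 1) * D) with hX
  set Y := σ ^ (n - 1) * volume S ^ (q : ℝ)⁻¹ with hY
  have hYt : Y ≠ ⊤ := by
    have h1 : volume S ≠ ⊤ := measure_ne_top_of_subset hSρ measure_closedBall_lt_top.ne
    exact ENNReal.mul_ne_top (by finiteness) (ENNReal.rpow_ne_top_of_nonneg (by positivity) h1)
  -- the estimate with error `a`, the distance of the smoothed positive part to the positive part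
  have key : ∀ a : ℝ, 0 < a → (∫⁻ x in ball 0 r,
      ENNReal.ofReal (excess f r R x ^ ((n : ℝ) / ((n : ℝ) - 1))) ∂(volG u)) ^
        (((n : ℝ) - 1) / (n : ℝ)) ≤ X + ENNReal.ofReal a * Y := by
    intro a ha
    obtain ⟨V, hV, hVF, hVD⟩ := exists_contDiff_rotated_excess (r := r) h0 hπ hRR' hu hH hf ha
    have hzero : volume (ball (0 : EuclideanSpace ℝ (Fin n)) r) ≤
        2 ^ (n + 1) * volume (S ∩ V ⁻¹' {0}) := by
      have h1 : F '' W ⊆ S ∩ V ⁻¹' {0} := by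
        rintro _ ⟨x, hx, rfl⟩
        refine ⟨⟨x, hx.1, rfl⟩, ?_⟩
        rw [Set.mem_preimage, ← hVF x (hrB hx.1), Set.mem_singleton_iff]
        exact smoothedPosPart_of_nonpos (sub_nonpos.2 hx.2)
      calc volume (ball (0 : EuclideanSpace ℝ (Fin n)) r) ≤ 2 * volume W := hW
        _ ≤ 2 * (2 ^ n * volume (F '' W)) := by
            gcongr
            exact volume_le_volume_image_rotatedMap h0 hπ hU hUc hu hH hWm hWU
        _ ≤ 2 * (2 ^ n * volume (S ∩ V ⁻¹' {0})) := by gcongr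
        _ = _ := by rw [pow_succ]; ring
    have hVS := hmain V hV (ε / 3) r ρ (by positivity) (by linarith) hr (by linarith) S T hSm hSc
      hSρ hTm hST hzero
    have hVa : eLpNorm (V + fun _ => a) q (volume.restrict S) ≤
        K * ENNReal.ofReal (ρ ^ 2 / (r * (ε / 3))) ^ (n - 1) * D +
          ENNReal.ofReal a * volume S ^ (q : ℝ)⁻¹ := by
      refine (eLpNorm_add_le hV.continuous.aestronglyMeasurable aestronglyMeasurable_const
        hq1).trans (add_le_add (hVS.trans (by gcongr)) ?_)
      rw [eLpNorm_const' a (by positivity) ENNReal.coe_ne_top, Real.enorm_eq_ofReal ha.le]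
      simp
    have hint : ∫⁻ x in ball 0 r,
        ENNReal.ofReal (excess f r R x ^ ((n : ℝ) / ((n : ℝ) - 1))) ∂(volG u) ≤
          σ ^ n * eLpNorm (V + fun _ => a) q (volume.restrict S) ^ (q : ℝ) := by
      rw [eLpNorm_nnreal_pow_eq_lintegral hconj.symm.pos.ne', ← hqr]
      refine le_trans ?_ (setLIntegral_volG_le h0 hπ hU hUc hu hH measurableSet_ball
        (hrB.trans hBU) _)
      rw [setLIntegral_volG measurableSet_ball, setLIntegral_volG measurableSet_ball]
      refine setLIntegral_mono' measurableSet_ball fun x hx => ?_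
      gcongr
      rw [excess, ← ENNReal.ofReal_rpow_of_nonneg (le_max_right _ _) hqr0.le, Pi.add_apply,
        ← hVF x (hrB hx), Real.enorm_eq_ofReal (add_nonneg (smoothedPosPart_nonneg ha _) ha.le)]
      gcongr
      exact max_le_smoothedPosPart_add ha _
    have hσpow : (σ ^ n) ^ (q : ℝ)⁻¹ = σ ^ (n - 1) := by
      rw [← ENNReal.rpow_natCast, ← ENNReal.rpow_mul, ← hqinv,
        mul_div_cancel₀ _ (by positivity : (n : ℝ) ≠ 0), ← ENNReal.rpow_natCast,
        Nat.cast_sub (by omega), Nat.cast_one]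
    rw [hqinv]
    calc _ ≤ (σ ^ n * eLpNorm (V + fun _ => a) q (volume.restrict S) ^ (q : ℝ)) ^ (q : ℝ)⁻¹ := by
          gcongr
      _ = σ ^ (n - 1) * eLpNorm (V + fun _ => a) q (volume.restrict S) := by
          rw [ENNReal.mul_rpow_of_nonneg _ _ (by positivity), hσpow,
            ENNReal.rpow_rpow_inv hqr0.ne']
      _ ≤ σ ^ (n - 1) * (K * ENNReal.ofReal (ρ ^ 2 / (r * (ε / 3))) ^ (n - 1) * D +
          ENNReal.ofReal a * volume S ^ (q : ℝ)⁻¹) := by gcongr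
      _ = _ := by rw [hX, hY]; ring
  have hlim : Filter.Tendsto (fun a : ℝ => X + ENNReal.ofReal a * Y) (nhdsWithin 0 (Set.Ioi 0))
      (nhds X) := by
    have h1 : Filter.Tendsto (fun a : ℝ => X + ENNReal.ofReal a * Y) (nhds 0)
        (nhds (X + ENNReal.ofReal 0 * Y)) :=
      tendsto_const_nhds.add (ENNReal.Tendsto.mul_const (ENNReal.tendsto_ofReal Filter.tendsto_id)
        (Or.inr hYt))
    simpa using h1.mono_left nhdsWithin_le_nhds
  refine (ge_of_tendsto hlim (eventually_nhdsWithin_of_forall key)).trans ?_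
  have hσ1 : 1 ≤ σ := by
    rw [hσ, ENNReal.one_le_ofReal, one_le_div hs]
    exact Real.sin_le_one _
  have hbase : σ * ENNReal.ofReal (ρ ^ 2 / (r * (ε / 3))) ≤
      3 * (ENNReal.ofReal ((1 / Real.sin (δ / 2)) ^ 2) * rho u R' ^ 2 /
        ENNReal.ofReal (r * ε)) := by
    have e1 : ρ ^ 2 / (r * (ε / 3)) = 3 * (ρ ^ 2 / (r * ε)) := by field_simp
    rw [e1, ENNReal.ofReal_mul (by positivity), ENNReal.ofReal_ofNat,
      ENNReal.ofReal_div_of_pos (by positivity), ENNReal.ofReal_pow (by positivity),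
      ENNReal.ofReal_pow (by positivity), ← hσ]
    calc σ * (3 * (ENNReal.ofReal ρ ^ 2 / ENNReal.ofReal (r * ε)))
        = 3 * (σ * ENNReal.ofReal ρ ^ 2 / ENNReal.ofReal (r * ε)) := by
          simp only [div_eq_mul_inv]; ring
      _ ≤ _ := by
          gcongr
          exact le_self_pow hσ1 two_ne_zero
  have hKC : K * 3 ^ (n - 1) ≤ ENNReal.ofReal ((K * 3 ^ (n - 1)).toReal + 1) := by
    rw [ENNReal.ofReal_add ENNReal.toReal_nonneg zero_le_one, ENNReal.ofReal_toReal (by finiteness)]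
    exact le_self_add
  calc X = K * (σ * ENNReal.ofReal (ρ ^ 2 / (r * (ε / 3)))) ^ (n - 1) * D := by
        rw [hX, mul_pow]; ring
    _ ≤ K * (3 * (ENNReal.ofReal ((1 / Real.sin (δ / 2)) ^ 2) * rho u R' ^ 2 /
          ENNReal.ofReal (r * ε))) ^ (n - 1) * D := by gcongr
    _ = K * 3 ^ (n - 1) * (ENNReal.ofReal ((1 / Real.sin (δ / 2)) ^ 2) * rho u R' ^ 2 /
          ENNReal.ofReal (r * ε)) ^ (n - 1) * D := by rw [mul_pow]; ring
    _ ≤ _ := by gcongr
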